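/- $\mathrm{NEXP}\not\subseteq \mathrm{r.o.}\text{-}\mathrm{NP}$, that is, there is a language $L\in\mathrm{NEXP}$ which has no robustly-often simulation in $\mathrm{NP}$. Here languages are subsets of $\{0,1\}^*$; $\mathrm{NTIME}(t)$ is the class of languages accepted by a nondeterministic multitape Turing machine all of whose computation paths on inputs of length $n$ halt within $O(t(n))$ steps; $\mathrm{NP}=\bigcup_{k}\mathrm{NTIME}(n^k)$ and $\mathrm{NEXP}=\bigcup_{k}\mathrm{NTIME}(2^{n^k})$. A set $S$ of positive integers is robust if for every positive integer $k$ there is an integer $m\ge 2$ such that $n\in S$ for all $m\le n\le m^k$. For a class $\mathcal C$ of languages, $L\in\mathrm{r.o.}\text{-}\mathcal C$ means that there are a robust set $S$ and a language $L'\in\mathcal C$ with $L\cap\{0,1\}^n=L'\cap\{0,1\}^n$ for all $n\in S$. -/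

import Mathlib

namespace Complexity

/-- A nondeterministic multitape Turing machine with input alphabet `{0,1}`. The tapes are indexed
by the finite type `K` and are infinite in both directions; `default : Γ` is the blank symbol. -/
structure NTM where
  /-- the index set of the tapes -/
  K : Type
  [decEqK : DecidableEq K]
  [fintypeK : Fintype K]
  /-- the tape that holds the input -/
  inputTape : K
  /-- the tape alphabet -/
  Γ : Type
  [fintypeΓ : Fintype Γ]
  [inhabitedΓ : Inhabited Γ]
  /-- the input bits as tape symbols -/
  bit : Bool → Γ
  bit_injective : Function.Injective bit
  bit_ne_blank : ∀ b, bit b ≠ default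
  /-- the set of states -/
  Q : Type
  [fintypeQ : Fintype Q]
  /-- the start state -/
  start : Q
  /-- the accepting states -/
  accept : Set Q
  /-- The transition relation: from the state and the symbols under the heads to the possible
  actions. An action consists of a new state and, for each tape, the symbol to be written and then
  the direction in which the head moves (`none`: the head stays). -/
  δ : Q → (K → Γ) → Set (Q × (K → Γ × Option Turing.Dir))

namespace NTM

attribute [instance] NTM.decEqK NTM.fintypeK NTM.fintypeΓ NTM.inhabitedΓ NTM.fintypeQ

variable (M : NTM)

/-- A configuration: the state and the tapes with their head positions. -/
structure Cfg where
  state : M.Q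
  tape : M.K → Turing.Tape M.Γ

/-- The initial configuration: the start state, the input on the input tape with the head on its
first symbol, and all other tapes blank. -/
def init (x : List Bool) : M.Cfg where
  state := M.start
  tape i := if i = M.inputTape then Turing.Tape.mk₁ (x.map M.bit) else Turing.Tape.mk₁ []

/-- Write a symbol, then move the head (or leave it where it is). -/
def act {Γ : Type} [Inhabited Γ] (a : Γ × Option Turing.Dir) (T : Turing.Tape Γ) :
    Turing.Tape Γ :=
  match a.2 with
  | none => T.write a.1
  | some d => (T.write a.1).move d

/-- `M.Step c d`: the machine can pass from `c` to `d` in one step. -/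
def Step (c d : M.Cfg) : Prop :=
  ∃ a ∈ M.δ c.state (fun i => (c.tape i).head),
    d = ⟨a.1, fun i => act (a.2 i) (c.tape i)⟩

/-- `M.ReachesIn n c d`: some computation path leads from `c` to `d` in exactly `n` steps. -/
def ReachesIn : ℕ → M.Cfg → M.Cfg → Prop
  | 0, c, d => c = d
  | n + 1, c, d => ∃ e, M.Step c e ∧ ReachesIn n e d

/-- A configuration is halted if no step is possible. -/
def Halted (c : M.Cfg) : Prop :=
  ∀ d, ¬ M.Step c d

/-- Every computation path on input `x` has at most `t` steps. -/
def HaltsWithin (x : List Bool) (t : ℕ) : Prop :=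
  ∀ n c, M.ReachesIn n (M.init x) c → n ≤ t

/-- Some computation path on input `x` halts in an accepting state. -/
def Accepts (x : List Bool) : Prop :=
  ∃ n c, M.ReachesIn n (M.init x) c ∧ M.Halted c ∧ c.state ∈ M.accept

end NTM

/-- `NTIME t`: the languages over `{0,1}` that are accepted by a nondeterministic multitape Turing
machine all of whose computation paths on inputs of length `n` halt within `O(t n)` steps.
(The additive constant only matters where `t` vanishes, as `n ^ k` does at `n = 0`.) -/
def NTIME (t : ℕ → ℕ) : Set (Language Bool) :=
  {L | ∃ (M : NTM) (c : ℕ), ∀ x : List Bool,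
    M.HaltsWithin x (c * t x.length + c) ∧ (M.Accepts x ↔ x ∈ L)}

/-- Nondeterministic polynomial time. -/
def NP : Set (Language Bool) :=
  ⋃ k : ℕ, NTIME (fun n => n ^ k)

/-- Nondeterministic exponential time, with time bounds `2 ^ (n ^ k)`. -/
def NEXP : Set (Language Bool) :=
  ⋃ k : ℕ, NTIME (fun n => 2 ^ (n ^ k))

/-- The set of words of length `n` in the language `L`. -/
def slice (L : Language Bool) (n : ℕ) : Set (List Bool) :=
  {x | x ∈ L ∧ x.length = n}

/-- A set of positive integers is robust if for every positive `k` it contains all integers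
between `m` and `m ^ k` for some `m ≥ 2`. -/
def IsRobust (S : Set ℕ) : Prop :=
  (∀ n ∈ S, 0 < n) ∧ ∀ k : ℕ, 0 < k → ∃ m : ℕ, 2 ≤ m ∧ ∀ n : ℕ, m ≤ n → n ≤ m ^ k → n ∈ S

/-- `L ∈ C` on `S`: some language in `C` agrees with `L` at all input lengths in `S`. -/
def InClassOn (L : Language Bool) (C : Set (Language Bool)) (S : Set ℕ) : Prop :=
  ∃ L' ∈ C, ∀ n ∈ S, slice L n = slice L' n

/-- The languages that are robustly often in the class `C`. -/
def ro (C : Set (Language Bool)) : Set (Language Bool) :=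
  {L | ∃ S : Set ℕ, IsRobust S ∧ InClassOn L C S}

end Complexity

/-! The proof is a delayed diagonalization whose delay is only polynomial, so that it fits into one
interval of a robust set. A fixed universal machine reads its input as `w ++ y`, where `w` is a
self-delimiting code word for a nondeterministic machine `M` and a number `b`. While `y` is shorter
than `2 ^ b`, the input is accepted if and only if `M` accepts `w ++ y` extended by either bit; this
conjunction costs just two guessed simulations. Once `y` has length at least `2 ^ b`, it is read as
a witness for an accepting computation of `M` on `w` itself, and the input is accepted if and only
if the witness is wrong. That check is deterministic, so no nondeterministic computation is ever
complemented.

Suppose that an NP machine `M` agrees with this language on a robust set. Take `w` of length `4 *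
m`, with `2 ^ b` large enough for the witnesses for `w` but polynomial in `4 * m`, such that all
lengths from `4 * m` to `4 * m + 2 ^ b` lie in the set. Going up the binary tree of the words `y`,
one finds that `M` accepts `w` if and only if it accepts `w ++ v` for all `v` of length `2 ^ b`,
hence if and only if no `v` is a right witness, hence if and only if `M` does not accept `w`. This
contradiction is `universalLanguage_notMem_ro_NP`; the numbers come from `exists_parameters` and
`IsRobust.exists_interval`.

The simulation has to handle any number of tapes with a fixed number of stacks. A witness picks a
sequence of rules, and each rule prescribes the state, the symbols under all heads and those to
their left. Such a sequence describes a computation as soon as it can be replayed on each tape, and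
on the state, separately; the common sequence synchronizes the replays. So the code of a machine has
one section for each tape and one for the state, and two stacks serve for the two halves of the tape
of the current section (`verdict_fullCode`, `Coding.sound`, `Coding.complete`). On inputs of length
`n` the guessed witnesses have `2 ^ n` bits, which suffices for every polynomial time bound once `n`
is large.

The universal machine is written as a structured stack program. `Prog.Spec` records both the running
time and the set of possible final stores, `Prog.toNTM_spec` transfers this to a Turing machine, and
`Prog.spec_universal` gives time `O(2 ^ (4 * n))`. -/

namespace Complexity

/-! ### Tokens, stacks and stores of the universal machine -/

/-- The tokens in which a simulated machine is coded. -/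
inductive Tok where
  | push (left b : Bool)
  | pop (left b : Bool)
  | rule
  | endSection
  | endCode
  | double
  | pad
  deriving DecidableEq, Fintype

/-- The stack symbols of the universal machine. -/
inductive Sym where
  | bit (b : Bool)
  | tok (t : Tok)
  deriving DecidableEq, Fintype

/-- The stacks of the universal machine. -/
inductive Stk where
  | X | W | W2 | Y | Y2 | G | D | P | P2 | C0 | C1 | C | S | S2 | T | A | U | U2 | L | R | F
  deriving DecidableEq

instance : Fintype Stk where
  elems := {.X, .W, .W2, .Y, .Y2, .G, .D, .P, .P2, .C0, .C1, .C, .S, .S2, .T, .A, .U, .U2, .L, .R,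
    .F}
  complete i := by cases i <;> decide

/-- The stacks that take part in the replay of a section. -/
structure Core where
  A : List Sym
  U : List Sym
  U2 : List Sym
  L : List Sym
  R : List Sym
  F : List Sym

/-- The contents of the stacks. -/
structure Store where
  X : List Sym
  W : List Sym
  W2 : List Sym
  Y : List Sym
  Y2 : List Sym
  G : List Sym
  D : List Sym
  P : List Sym
  P2 : List Sym
  C0 : List Sym
  C1 : List Sym
  C : List Sym
  S : List Sym
  S2 : List Sym
  T : List Sym
  core : Core

namespace Store

def get (s : Store) : Stk → List Sym
  | .X => s.X
  | .W => s.W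
  | .W2 => s.W2
  | .Y => s.Y
  | .Y2 => s.Y2
  | .G => s.G
  | .D => s.D
  | .P => s.P
  | .P2 => s.P2
  | .C0 => s.C0
  | .C1 => s.C1
  | .C => s.C
  | .S => s.S
  | .S2 => s.S2
  | .T => s.T
  | .A => s.core.A
  | .U => s.core.U
  | .U2 => s.core.U2
  | .L => s.core.L
  | .R => s.core.R
  | .F => s.core.F

def set (s : Store) (i : Stk) (l : List Sym) : Store :=
  match i with
  | .X => { s with X := l }
  | .W => { s with W := l }
  | .W2 => { s with W2 := l }
  | .Y => { s with Y := l }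
  | .Y2 => { s with Y2 := l }
  | .G => { s with G := l }
  | .D => { s with D := l }
  | .P => { s with P := l }
  | .P2 => { s with P2 := l }
  | .C0 => { s with C0 := l }
  | .C1 => { s with C1 := l }
  | .C => { s with C := l }
  | .S => { s with S := l }
  | .S2 => { s with S2 := l }
  | .T => { s with T := l }
  | .A => { s with core := { s.core with A := l } }
  | .U => { s with core := { s.core with U := l } }
  | .U2 => { s with core := { s.core with U2 := l } }
  | .L => { s with core := { s.core with L := l } }
  | .R => { s with core := { s.core with R := l } }
  | .F => { s with core := { s.core with F := l } }

theorem get_set (s : Store) (i j : Stk) (l : List Sym) :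
    (s.set i l).get j = if j = i then l else s.get j := by
  cases i <;> cases j <;> rfl

@[simp] theorem get_set_self (s : Store) (i : Stk) (l : List Sym) : (s.set i l).get i = l := by
  rw [get_set, if_pos rfl]

theorem get_set_ne (s : Store) {i j : Stk} (h : j ≠ i) (l : List Sym) :
    (s.set i l).get j = s.get j := by
  rw [get_set, if_neg h]

@[simp] theorem set_get (s : Store) (i : Stk) : s.set i (s.get i) = s := by
  cases i <;> rfl

@[simp] theorem set_set (s : Store) (i : Stk) (l l' : List Sym) :
    (s.set i l).set i l' = s.set i l' := by
  cases i <;> rfl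

/-- The tapes that hold the given stacks. -/
def tapes (s : Store) : Stk → Turing.Tape (Option Sym) :=
  fun i => Turing.Tape.mk₁ ((s.get i).map some)

end Store

/-! ### Stack programs and their compilation to Turing machines -/

/-- Structured nondeterministic programs that work on stacks. -/
inductive Prog where
  | skip
  | fail
  /-- move the head of tape `i` to the left -/
  | left (i : Stk)
  /-- write `a` on tape `i` -/
  | put (i : Stk) (a : Sym)
  /-- pop a symbol from stack `i` and branch on the result -/
  | pop (i : Stk) (f : Option Sym → Prog)
  /-- pop the symbols `a` of stack `i` until it is empty, and run `f a` for each of them -/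
  | loop (i : Stk) (f : Sym → Prog)
  | seq (p q : Prog)
  | choice (p q : Prog)

namespace Prog

open Turing

/-- The action on the tapes that acts on tape `i` only. -/
def onTape (h : Stk → Option Sym) (i : Stk) (a : Option Sym × Option Dir) :
    Stk → Option Sym × Option Dir :=
  fun j => if j = i then a else (h j, none)

/-- The action on the tapes that changes nothing. -/
def stay (h : Stk → Option Sym) : Stk → Option Sym × Option Dir :=
  fun j => (h j, none)

/-- The transitions of a list of programs that remain to be run. -/
def next : List Prog → (Stk → Option Sym) → Set (List Prog × (Stk → Option Sym × Option Dir))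
  | [], _ => ∅
  | skip :: k, h => {(k, stay h)}
  | fail :: _, _ => ∅
  | left i :: k, h => {(k, onTape h i (h i, some .left))}
  | put i a :: k, h => {(k, onTape h i (some a, none))}
  | pop i f :: k, h => {(f (h i) :: k, onTape h i (none, some .right))}
  | loop i f :: k, h =>
    match h i with
    | none => {(k, stay h)}
    | some a => {(f a :: loop i f :: k, onTape h i (none, some .right))}
  | seq p q :: k, h => {(p :: q :: k, stay h)}
  | choice p q :: k, h => {(p :: k, stay h), (q :: k, stay h)}

/-- The lists of programs that may remain to be run while `p` is run before `k`. -/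
def points : Prog → List Prog → Set (List Prog)
  | skip, k => {skip :: k}
  | fail, k => {fail :: k}
  | left i, k => {left i :: k}
  | put i a, k => {put i a :: k}
  | pop i f, k => {pop i f :: k} ∪ ⋃ o, points (f o) k
  | loop i f, k => {loop i f :: k} ∪ ⋃ a, points (f a) (loop i f :: k)
  | seq p q, k => {seq p q :: k} ∪ (points p (q :: k) ∪ points q k)
  | choice p q, k => {choice p q :: k} ∪ (points p k ∪ points q k)

/-- This makes the lists of remaining programs usable as the states of a machine. -/
theorem finite_points (p : Prog) : ∀ k, (points p k).Finite := by
  induction p with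
  | skip | fail | left | put => intro k; exact Set.finite_singleton _
  | pop i f ih => intro k; exact (Set.finite_singleton _).union (Set.finite_iUnion fun o => ih o k)
  | loop i f ih => intro k; exact (Set.finite_singleton _).union (Set.finite_iUnion fun o => ih o _)
  | seq p q hp hq => intro k; exact (Set.finite_singleton _).union ((hp _).union (hq _))
  | choice p q hp hq => intro k; exact (Set.finite_singleton _).union ((hp _).union (hq _))

theorem self_mem_points (p : Prog) (k : List Prog) : p :: k ∈ points p k := by
  cases p <;> simp [points]

theorem next_mem_points (p : Prog) : ∀ k, ∀ c ∈ points p k, ∀ h, ∀ a ∈ next c h,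
    a.1 ∈ points p k ∨ a.1 = k := by
  induction p with
  | skip => rintro k c rfl h a rfl; exact Or.inr rfl
  | fail => rintro k c rfl h a ha; exact ha.elim
  | left => rintro k c rfl h a rfl; exact Or.inr rfl
  | put => rintro k c rfl h a rfl; exact Or.inr rfl
  | pop i f ih =>
    rintro k c (rfl | hc) h a ha
    · obtain rfl := ha
      exact Or.inl (Or.inr (Set.mem_iUnion.2 ⟨_, self_mem_points _ _⟩))
    · obtain ⟨o, ho⟩ := Set.mem_iUnion.1 hc
      exact (ih o k c ho h a ha).imp_left fun hm => Or.inr (Set.mem_iUnion.2 ⟨o, hm⟩)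
  | loop i f ih =>
    rintro k c (rfl | hc) h a ha
    · rw [next] at ha
      split at ha
      · obtain rfl := ha; exact Or.inr rfl
      · obtain rfl := ha
        exact Or.inl (Or.inr (Set.mem_iUnion.2 ⟨_, self_mem_points _ _⟩))
    · obtain ⟨o, ho⟩ := Set.mem_iUnion.1 hc
      rcases ih o _ c ho h a ha with hm | hm
      · exact Or.inl (Or.inr (Set.mem_iUnion.2 ⟨o, hm⟩))
      · exact Or.inl (Or.inl hm)
  | seq p q hp hq =>
    rintro k c (rfl | hc | hc) h a ha
    · obtain rfl := ha
      exact Or.inl (Or.inr (Or.inl (self_mem_points _ _)))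
    · rcases hp _ c hc h a ha with hm | hm
      · exact Or.inl (Or.inr (Or.inl hm))
      · exact Or.inl (Or.inr (Or.inr (hm ▸ self_mem_points _ _)))
    · exact (hq _ c hc h a ha).imp_left fun hm => Or.inr (Or.inr hm)
  | choice p q hp hq =>
    rintro k c (rfl | hc | hc) h a ha
    · rcases ha with rfl | rfl
      · exact Or.inl (Or.inr (Or.inl (self_mem_points _ _)))
      · exact Or.inl (Or.inr (Or.inr (self_mem_points _ _)))
    · exact (hp _ c hc h a ha).imp_left fun hm => Or.inr (Or.inl hm)
    · exact (hq _ c hc h a ha).imp_left fun hm => Or.inr (Or.inr hm)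

abbrev Conf := List Prog × (Stk → Tape (Option Sym))

def Step (c d : Conf) : Prop :=
  ∃ a ∈ next c.1 (fun i => (c.2 i).head), d = (a.1, fun i => NTM.act (a.2 i) (c.2 i))

/-- All computations from the configuration have at most the given number of steps. -/
def HaltsIn : ℕ → Conf → Prop
  | 0, c => ∀ d, ¬ Step c d
  | t + 1, c => ∀ d, Step c d → HaltsIn t d

theorem HaltsIn.succ {t : ℕ} {c : Conf} (h : HaltsIn t c) : HaltsIn (t + 1) c := by
  induction t generalizing c with
  | zero => intro d hd; exact absurd hd (h d)
  | succ t ih => intro d hd; exact ih (h d hd)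

theorem HaltsIn.mono {t t' : ℕ} {c : Conf} (h : HaltsIn t c) (ht : t ≤ t') : HaltsIn t' c := by
  induction ht with
  | refl => exact h
  | step _ ih => exact ih.succ

/-- Some computation from the configuration runs the whole program. -/
inductive CanFinish : Conf → Prop
  | done (T) : CanFinish ([], T)
  | step {c d} : Step c d → CanFinish d → CanFinish c

theorem canFinish_iff {c : Conf} (hc : c.1 ≠ []) :
    CanFinish c ↔ ∃ d, Step c d ∧ CanFinish d := by
  constructor
  · rintro (_ | ⟨h, h'⟩)
    · exact absurd rfl hc
    · exact ⟨_, h, h'⟩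
  · rintro ⟨d, h, h'⟩
    exact .step h h'

section Machine

/-- The Turing machine that runs the program `p`. -/
noncomputable def toNTM (p : Prog) : NTM where
  K := Stk
  inputTape := .X
  Γ := Option Sym
  bit b := some (.bit b)
  bit_injective a b h := by simpa using h
  bit_ne_blank b := by simp [default]
  Q := {k : List Prog // k ∈ points p [] ∨ k = []}
  fintypeQ := ((finite_points p []).union (Set.finite_singleton [])).fintype
  start := ⟨[p], Or.inl (self_mem_points _ _)⟩
  accept := {k | k.1 = []}
  δ k h := {a | (a.1.1, a.2) ∈ next k.1 h}

variable {p : Prog}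

def conf (c : p.toNTM.Cfg) : Conf := (c.state.1, c.tape)

theorem step_conf {c d : p.toNTM.Cfg} (h : p.toNTM.Step c d) : Step (conf c) (conf d) := by
  obtain ⟨a, ha, rfl⟩ := h
  exact ⟨_, ha, rfl⟩

/-- Transitions never leave the finite set of program points, so every step of the program is also
one of the machine. -/
theorem exists_of_step_conf {c : p.toNTM.Cfg} {e : Conf} (h : Step (conf c) e) :
    ∃ d, p.toNTM.Step c d ∧ conf d = e := by
  obtain ⟨a, ha, rfl⟩ := h
  have hm : a.1 ∈ points p [] ∨ a.1 = [] := by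
    rcases c.state.2 with hc | hc
    · exact next_mem_points p [] _ hc _ _ ha
    · have : (conf c).1 = [] := hc
      rw [this] at ha
      exact ha.elim
  exact ⟨⟨⟨a.1, hm⟩, _⟩, ⟨⟨⟨a.1, hm⟩, a.2⟩, ha, rfl⟩, rfl⟩

theorem le_of_haltsIn {n : ℕ} : ∀ {t : ℕ} {c d : p.toNTM.Cfg}, HaltsIn t (conf c) →
    p.toNTM.ReachesIn n c d → n ≤ t := by
  induction n with
  | zero => intros; exact Nat.zero_le _
  | succ n ih =>
    rintro (_ | t) c d h ⟨e, he, hd⟩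
    · exact absurd (step_conf he) (h _)
    · exact Nat.succ_le_succ (ih (h _ (step_conf he)) hd)

/-- The accepting state is the empty list, which has no transitions, so a finished program has
halted. A path that ends in `fail` halts with a nonempty list and does not accept. -/
theorem canFinish_conf_iff {c : p.toNTM.Cfg} : CanFinish (conf c) ↔
    ∃ n d, p.toNTM.ReachesIn n c d ∧ p.toNTM.Halted d ∧ d.state ∈ p.toNTM.accept := by
  constructor
  · intro h
    generalize hc : conf c = e at h
    induction h generalizing c with
    | done T =>
      have hs : (conf c).1 = [] := by rw [hc]
      refine ⟨0, c, rfl, ?_, hs⟩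
      intro d hd
      obtain ⟨a, ha, _⟩ := step_conf hd
      rw [hs] at ha
      exact ha
    | step h _ ih =>
      subst hc
      obtain ⟨d, hd, rfl⟩ := exists_of_step_conf h
      obtain ⟨n, f, hr, hf⟩ := ih rfl
      exact ⟨n + 1, f, ⟨d, hd, hr⟩, hf⟩
  · rintro ⟨n, d, hr, -, hd⟩
    induction n generalizing c with
    | zero =>
      obtain rfl : c = d := hr
      have : conf c = ([], (conf c).2) := Prod.ext hd rfl
      rw [this]
      exact .done _
    | succ n ih =>
      obtain ⟨e, he, hr⟩ := hr
      exact .step (step_conf he) (ih hr)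

end Machine

/-! ### Specifications: running time and possible results -/

/-- `Spec p s R t`: the computations of `p` on the store `s` have at most `t` steps, and `R` is the
set of the stores in which those that do not fail end. -/
def Spec (p : Prog) (s : Store) (R : Set Store) (t : ℕ) : Prop :=
  ∀ k, (∀ t', (∀ s' ∈ R, HaltsIn t' (k, s'.tapes)) → HaltsIn (t + t') (p :: k, s.tapes)) ∧
    (CanFinish (p :: k, s.tapes) ↔ ∃ s' ∈ R, CanFinish (k, s'.tapes))

theorem Spec.mono {p : Prog} {s : Store} {R : Set Store} {t t' : ℕ} (h : Spec p s R t)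
    (ht : t ≤ t') : Spec p s R t' := fun k =>
  ⟨fun _ hu => ((h k).1 _ hu).mono (by omega), (h k).2⟩

theorem spec_of_steps {p : Prog} {s : Store} {R : Set Store} {t : ℕ}
    (D : List Prog → Set Conf) (hD : ∀ k d, Step (p :: k, s.tapes) d ↔ d ∈ D k)
    (h : ∀ k t', (∀ s' ∈ R, HaltsIn t' (k, s'.tapes)) → ∀ d ∈ D k, HaltsIn (t + t') d)
    (h' : ∀ k, (∃ d ∈ D k, CanFinish d) ↔ ∃ s' ∈ R, CanFinish (k, s'.tapes)) :
    Spec p s R (t + 1) := by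
  refine fun k => ⟨fun t' ht => ?_, ?_⟩
  · rw [Nat.add_right_comm]
    intro d hd
    exact h k t' ht d ((hD k d).1 hd)
  · rw [canFinish_iff (by simp), ← h']
    simp only [hD]

theorem act_stay (T : Stk → Tape (Option Sym)) :
    (fun i => NTM.act (stay (fun i => (T i).head) i) (T i)) = T := by
  funext i
  exact Tape.write_self _

theorem tapes_set (s : Store) (i : Stk) (l : List Sym) :
    (s.set i l).tapes = fun j => if j = i then Tape.mk₁ (l.map some) else s.tapes j := by
  funext j
  simp only [Store.tapes, Store.get_set]
  split <;> rfl

theorem act_onTape (T : Stk → Tape (Option Sym)) (i : Stk) (a : Option Sym × Option Dir) :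
    (fun j => NTM.act (onTape (fun j => (T j).head) i a j) (T j)) =
      fun j => if j = i then NTM.act a (T j) else T j := by
  funext j
  by_cases h : j = i
  · simp [onTape, h]
  · simp only [onTape, h, if_false]
    exact Tape.write_self _

theorem head_tapes (s : Store) (i : Stk) : (s.tapes i).head = (s.get i).head? := by
  unfold Store.tapes
  cases s.get i <;> rfl

/-- The blank that is left behind merges with the blank left half, so the tape again has the form of
a stack with the head on its top. Popping an empty stack changes nothing. -/
theorem act_pop (l : List Sym) :
    NTM.act (none, some .right) (Tape.mk₁ (l.map some)) = Tape.mk₁ (l.tail.map some) := by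
  have hblank : ListBlank.mk [none] = (ListBlank.mk [] : ListBlank (Option Sym)) := by
    ext n
    cases n <;> rfl
  cases l <;>
    simp only [NTM.act, Tape.mk₁, Tape.mk₂, Tape.write_mk', Tape.move_right_mk',
      ListBlank.tail_mk, ListBlank.cons_mk,
      List.map_nil, List.map_cons, List.tail_nil, List.tail_cons]
  · exact congrArg (Tape.mk' · _) hblank
  · exact congrArg (Tape.mk' · _) hblank

theorem act_push (l : List Sym) (a : Sym) :
    NTM.act (some a, none) (NTM.act ((Tape.mk₁ (l.map some)).head, some .left)
      (Tape.mk₁ (l.map some))) = Tape.mk₁ ((a :: l).map some) := by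
  have h : NTM.act ((Tape.mk₁ (l.map some)).head, some .left) (Tape.mk₁ (l.map some)) =
      (Tape.mk₁ (l.map some)).move .left := by
    simp only [NTM.act, Tape.write_self]
  rw [h]
  simp only [NTM.act, Tape.mk₁, Tape.mk₂, Tape.write_mk', Tape.move_left_mk',
      ListBlank.tail_mk, ListBlank.cons_mk, List.map_cons, List.tail_nil, List.tail_cons]

theorem tapes_pop (s : Store) (i : Stk) :
    (fun j => if j = i then NTM.act (none, some .right) (s.tapes j) else s.tapes j) =
      (s.set i (s.get i).tail).tapes := by
  rw [tapes_set]
  funext j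
  split
  · subst j; exact act_pop _
  · rfl

theorem spec_skip (s : Store) : Spec skip s {s} 1 := by
  refine spec_of_steps (t := 0) (fun k => {(k, s.tapes)}) (fun k d => ?_) ?_ ?_
  · simp [Step, next, act_stay]
  · intro k t' h d hd
    obtain rfl := hd
    simpa using h s rfl
  · simp

theorem spec_fail (s : Store) : Spec fail s ∅ 1 := by
  refine spec_of_steps (t := 0) (fun k => ∅) (fun k d => ?_) ?_ ?_
  · simp [Step, next]
  · simp
  · simp

/-- Push the symbol `a` on the stack `i`. -/
def push (i : Stk) (a : Sym) : Prog := seq (left i) (put i a)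

theorem spec_of_step {p : Prog} {s : Store} {R : Set Store} {t : ℕ}
    (c : List Prog → Conf) (hD : ∀ k d, Step (p :: k, s.tapes) d ↔ d = c k)
    (h : ∀ k, (∀ t', (∀ s' ∈ R, HaltsIn t' (k, s'.tapes)) → HaltsIn (t + t') (c k)) ∧
      (CanFinish (c k) ↔ ∃ s' ∈ R, CanFinish (k, s'.tapes))) :
    Spec p s R (t + 1) := by
  refine spec_of_steps (fun k => {c k}) hD ?_ ?_
  · rintro k t' h' d rfl
    exact (h k).1 t' h'
  · simpa using fun k => (h k).2

/-- The set of results is that of a composition of relations. The time `t'` has to be uniform over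
all stores that `p` may produce. -/
theorem spec_seq {p q : Prog} {s : Store} {R R' : Set Store} {t t' : ℕ}
    (hp : Spec p s R t) {F : Store → Set Store} (hq : ∀ s' ∈ R, Spec q s' (F s') t')
    (hR : R' = ⋃ s' ∈ R, F s') : Spec (seq p q) s R' (t + t' + 1) := by
  refine spec_of_step (fun k => (p :: q :: k, s.tapes)) (fun k d => ?_) fun k => ⟨?_, ?_⟩
  · simp [Step, next, act_stay]
  · intro u hu
    rw [Nat.add_assoc]
    refine (hp _).1 _ fun s' hs' => ((hq s' hs') k).1 _ fun s'' hs'' => hu s'' ?_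
    rw [hR]
    exact Set.mem_biUnion hs' hs''
  · rw [(hp _).2, hR]
    simp only [Set.mem_iUnion]
    constructor
    · rintro ⟨s', hs', h⟩
      obtain ⟨s'', h1, h2⟩ := ((hq s' hs' k).2).1 h
      exact ⟨s'', ⟨s', hs', h1⟩, h2⟩
    · rintro ⟨s'', ⟨s', hs', h1⟩, h2⟩
      exact ⟨s', hs', ((hq s' hs' k).2).2 ⟨s'', h1, h2⟩⟩

theorem spec_then {p q : Prog} {s s' : Store} {R : Set Store} {t t' : ℕ}
    (hp : Spec p s {s'} t) (hq : Spec q s' R t') : Spec (seq p q) s R (t + t' + 1) :=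
  spec_seq hp (F := fun _ => R) (by rintro _ rfl; exact hq) (by simp)

theorem spec_push (s : Store) (i : Stk) (a : Sym) :
    Spec (push i a) s {s.set i (a :: s.get i)} 3 := by
  have key : (s.set i (a :: s.get i)).tapes = fun j => if j = i then
      NTM.act (some a, none) (if j = i then NTM.act ((s.tapes i).head, some .left) (s.tapes j)
        else s.tapes j) else (if j = i then NTM.act ((s.tapes i).head, some .left) (s.tapes j)
        else s.tapes j) := by
    rw [tapes_set]
    funext j
    split
    · subst j; exact (act_push _ _).symm
    · rfl
  set T := fun j => if j = i then NTM.act ((s.tapes i).head, some .left) (s.tapes j)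
        else s.tapes j with hT
  have h1 : ∀ k d, Step (seq (left i) (put i a) :: k, s.tapes) d ↔
      d = (left i :: put i a :: k, s.tapes) := by
    intro k d; simp [Step, next, act_stay]
  have h2 : ∀ k d, Step (left i :: put i a :: k, s.tapes) d ↔ d = (put i a :: k, T) := by
    intro k d; simp [Step, next, act_onTape, hT]
  have h3 : ∀ k d, Step (put i a :: k, T) d ↔ d = (k, (s.set i (a :: s.get i)).tapes) := by
    intro k d; simp only [Step, next, Set.mem_singleton_iff, exists_eq_left, act_onTape, key, hT]
  refine spec_of_step (t := 2) _ h1 fun k => ⟨fun t' ht => ?_, ?_⟩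
  · rw [Nat.add_comm]
    intro d hd
    obtain rfl := (h2 _ _).1 hd
    intro d hd
    obtain rfl := (h3 _ _).1 hd
    exact ht _ rfl
  · rw [canFinish_iff (by simp)]
    simp only [h2, exists_eq_left]
    rw [canFinish_iff (by simp)]
    simp only [h3, exists_eq_left, Set.mem_singleton_iff]

theorem spec_pop {s : Store} {i : Stk} {f : Option Sym → Prog} {R : Set Store} {t : ℕ}
    (h : Spec (f (s.get i).head?) (s.set i (s.get i).tail) R t) : Spec (pop i f) s R (t + 1) := by
  refine spec_of_step _ (fun k d => ?_) h
  simp only [Step, next, act_onTape, Set.mem_singleton_iff, exists_eq_left, tapes_pop]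
  rw [head_tapes]

theorem spec_loop_nil {s : Store} {i : Stk} {f : Sym → Prog} (h : s.get i = []) :
    Spec (loop i f) s {s} 1 := by
  refine spec_of_step (t := 0) (fun k => (k, s.tapes)) (fun k d => ?_) fun k => by simp
  have : (s.tapes i).head = none := by rw [head_tapes, h]; rfl
  simp [Step, next, act_stay, this]

/-- One round of a loop behaves like a sequence of the body and the loop itself, since the body is
run before the same loop. -/
theorem spec_loop_cons' {s : Store} {i : Stk} {f : Sym → Prog} {a : Sym} {l : List Sym}
    {R R' : Set Store} {t t' : ℕ} (h : s.get i = a :: l) (ha : Spec (f a) (s.set i l) R t)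
    {F : Store → Set Store} (hl : ∀ s' ∈ R, Spec (loop i f) s' (F s') t')
    (hR : R' = ⋃ s' ∈ R, F s') : Spec (loop i f) s R' (t + t' + 1) := by
  refine spec_of_step (fun k => (f a :: loop i f :: k, (s.set i l).tapes)) (fun k d => ?_)
    fun k => ⟨fun u hu => ?_, ?_⟩
  · have : (s.tapes i).head = some a := by rw [head_tapes, h]; rfl
    have h' := tapes_pop s i
    rw [h, List.tail_cons] at h'
    simp only [Step, next, this, Set.mem_singleton_iff, exists_eq_left, act_onTape, h']
  · rw [Nat.add_assoc]
    refine (ha _).1 _ fun s' hs' => (hl s' hs' k).1 _ fun s'' hs'' => hu s'' ?_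
    rw [hR]
    exact Set.mem_biUnion hs' hs''
  · rw [(ha _).2, hR]
    simp only [Set.mem_iUnion]
    constructor
    · rintro ⟨s', hs', h⟩
      obtain ⟨s'', h1, h2⟩ := ((hl s' hs' k).2).1 h
      exact ⟨s'', ⟨s', hs', h1⟩, h2⟩
    · rintro ⟨s'', ⟨s', hs', h1⟩, h2⟩
      exact ⟨s', hs', ((hl s' hs' k).2).2 ⟨s'', h1, h2⟩⟩

theorem spec_loop_cons {s s' : Store} {i : Stk} {f : Sym → Prog} {a : Sym} {l : List Sym}
    {R : Set Store} {t t' : ℕ} (h : s.get i = a :: l) (ha : Spec (f a) (s.set i l) {s'} t)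
    (hl : Spec (loop i f) s' R t') : Spec (loop i f) s R (t + t' + 1) :=
  spec_loop_cons' h ha (F := fun _ => R) (by rintro _ rfl; exact hl) (by simp)

theorem spec_choice {p q : Prog} {s : Store} {R R' : Set Store} {t : ℕ}
    (hp : Spec p s R t) (hq : Spec q s R' t) : Spec (choice p q) s (R ∪ R') (t + 1) := by
  refine spec_of_steps (fun k => {(p :: k, s.tapes), (q :: k, s.tapes)}) (fun k d => ?_) ?_ ?_
  · simp [Step, next, or_and_right, exists_or, act_stay]
  · rintro k t' h d (rfl | rfl)
    · exact (hp k).1 _ fun s' hs' => h s' (Or.inl hs')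
    · exact (hq k).1 _ fun s' hs' => h s' (Or.inr hs')
  · intro k
    simp only [Set.mem_insert_iff, Set.mem_singleton_iff, exists_eq_left,
      (hp k).2, (hq k).2, Set.mem_union, or_and_right, exists_or]

/-- The store in which only the stack `X` is not empty. -/
def initStore (x : List Bool) : Store :=
  ⟨x.map .bit, [], [], [], [], [], [], [], [], [], [], [], [], [], [], ⟨[], [], [], [], [], []⟩⟩

theorem conf_init (p : Prog) (x : List Bool) :
    conf (p.toNTM.init x) = ([p], (initStore x).tapes) := by
  refine Prod.ext rfl ?_
  funext i
  by_cases h : i = Stk.X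
  · subst h
    simp only [conf, NTM.init, Store.tapes, toNTM, if_true, Store.get, initStore, List.map_map]
    rfl
  · simp only [conf, NTM.init, Store.tapes, toNTM]
    refine (if_neg h).trans ?_
    cases i <;> first | rfl | exact absurd rfl h

/-- A program decides a language within the time in which it halts on all inputs. -/
theorem toNTM_spec {p : Prog} {x : List Bool} {R : Set Store} {t : ℕ}
    (h : Spec p (initStore x) R t) :
    p.toNTM.HaltsWithin x t ∧ (p.toNTM.Accepts x ↔ R.Nonempty) := by
  constructor
  · intro n c hc
    refine le_of_haltsIn (t := t) ?_ hc
    rw [conf_init]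
    refine (h []).1 0 fun s' _ d hd => ?_
    obtain ⟨a, ha, -⟩ := hd
    exact ha
  · unfold NTM.Accepts
    rw [← canFinish_conf_iff, conf_init, (h []).2]
    exact ⟨fun ⟨s, hs, _⟩ => ⟨s, hs⟩, fun ⟨s, hs⟩ => ⟨s, hs, .done _⟩⟩

end Prog

/-! ### Moving, copying, clearing and folding over stacks -/

namespace Prog

theorem _root_.Complexity.Store.ext_get {s s' : Store} (h : ∀ i, s.get i = s'.get i) : s = s' := by
  obtain ⟨_, _, _, _, _, _, _, _, _, _, _, _, _, _, _, ⟨_, _, _, _, _, _⟩⟩ := s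
  obtain ⟨_, _, _, _, _, _, _, _, _, _, _, _, _, _, _, ⟨_, _, _, _, _, _⟩⟩ := s'
  have hX := h .X; have hW := h .W; have hW2 := h .W2; have hY := h .Y; have hY2 := h .Y2
  have hG := h .G; have hD := h .D; have hP := h .P; have hP2 := h .P2; have hC0 := h .C0
  have hC1 := h .C1; have hC := h .C; have hS := h .S; have hS2 := h .S2; have hT := h .T
  have hA := h .A; have hU := h .U; have hU2 := h .U2; have hL := h .L; have hR := h .R
  have hF := h .F
  simp only [Store.get] at *
  subst_vars
  rfl

theorem Spec.congr {p : Prog} {s s₁ s₂ : Store} {t t' : ℕ} (h : Spec p s {s₁} t)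
    (hs : s₁ = s₂) (ht : t ≤ t') : Spec p s {s₂} t' :=
  hs ▸ h.mono ht

theorem Spec.congr_set {p : Prog} {s : Store} {R R' : Set Store} {t t' : ℕ} (h : Spec p s R t)
    (hR : ∀ s', s' ∈ R ↔ s' ∈ R') (ht : t ≤ t') : Spec p s R' t' :=
  Set.ext hR ▸ h.mono ht

/-- Move the stack `i` to the stack `j`. -/
def mv (i j : Stk) : Prog := loop i fun a => push j a

/-- Move the stack `i` to both of the stacks `j` and `k`. -/
def dup (i j k : Stk) : Prog := loop i fun a => seq (push j a) (push k a)

/-- Empty the stack `i`. -/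
def clear (i : Stk) : Prog := loop i fun _ => skip

theorem spec_mv {i j : Stk} (hij : i ≠ j) (s : Store) :
    Spec (mv i j) s {(s.set i []).set j ((s.get i).reverse ++ s.get j)} (4 * (s.get i).length + 1) := by
  generalize hl : s.get i = l
  induction l generalizing s with
  | nil =>
    refine (spec_loop_nil hl).congr ?_ le_rfl
    apply Store.ext_get
    intro k
    simp only [Store.get_set]
    split_ifs <;> simp_all
  | cons a l ih =>
    have h1 := ih ((s.set i l).set j (a :: (s.set i l).get j))
      (by rw [Store.get_set_ne _ hij, Store.get_set_self])
    refine (spec_loop_cons hl (spec_push _ _ _) h1).congr ?_ (by simp only [List.length_cons]; omega)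
    apply Store.ext_get
    intro k
    simp only [Store.get_set]
    split_ifs <;> simp_all

theorem spec_dup {i j k : Stk} (hij : i ≠ j) (hik : i ≠ k) (hjk : j ≠ k) (s : Store) :
    Spec (dup i j k) s {((s.set i []).set j ((s.get i).reverse ++ s.get j)).set k
      ((s.get i).reverse ++ s.get k)} (8 * (s.get i).length + 1) := by
  generalize hl : s.get i = l
  induction l generalizing s with
  | nil =>
    refine (spec_loop_nil hl).congr ?_ le_rfl
    apply Store.ext_get
    intro k
    simp only [Store.get_set]
    split_ifs <;> simp_all
  | cons a l ih =>
    have h1 := ih (((s.set i l).set j (a :: (s.set i l).get j)).set k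
      (a :: ((s.set i l).set j (a :: (s.set i l).get j)).get k))
      (by rw [Store.get_set_ne _ hik, Store.get_set_ne _ hij, Store.get_set_self])
    refine (spec_loop_cons hl (spec_then (spec_push _ _ _) (spec_push _ _ _)) h1).congr ?_
      (by simp only [List.length_cons]; omega)
    apply Store.ext_get
    intro m
    simp only [Store.get_set]
    split_ifs <;> simp_all

theorem spec_clear (i : Stk) (s : Store) :
    Spec (clear i) s {s.set i []} (2 * (s.get i).length + 1) := by
  generalize hl : s.get i = l
  induction l generalizing s with
  | nil =>
    refine (spec_loop_nil hl).congr ?_ le_rfl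
    rw [← hl, Store.set_get]
  | cons a l ih =>
    have h1 := ih (s.set i l) (by simp)
    rw [Store.set_set] at h1
    exact (spec_loop_cons hl (spec_skip _) h1).mono (by simp only [List.length_cons]; omega)

/-- The hypothesis `hg` says that the body neither reads nor changes the stack of the loop, so the
symbols processed are those present at the start. -/
theorem spec_loop_foldl {i : Stk} {f : Sym → Prog} {g : Sym → Store → Store} {t : ℕ}
    (hf : ∀ a s, Spec (f a) s {g a s} t) (hg : ∀ a s l, g a (s.set i l) = (g a s).set i l)
    (s : Store) : Spec (loop i f) s {((s.get i).foldl (fun s a => g a s) s).set i []}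
      ((t + 1) * (s.get i).length + 1) := by
  have hfold : ∀ (l : List Sym) (s : Store) (l' : List Sym),
      l.foldl (fun s a => g a s) (s.set i l') = (l.foldl (fun s a => g a s) s).set i l' := by
    intro l
    induction l with
    | nil => intros; rfl
    | cons a l ih => intro s l'; rw [List.foldl_cons, hg, ih, List.foldl_cons]
  generalize hl : s.get i = l
  induction l generalizing s with
  | nil =>
    refine (spec_loop_nil hl).congr ?_ (by omega)
    · rw [List.foldl_nil, ← hl, Store.set_get]
  | cons a l ih =>
    have h1 := ih (g a (s.set i l)) (by rw [hg]; simp)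
    rw [hg, hfold, Store.set_set] at h1
    refine (spec_loop_cons hl (hf _ _) (by rw [hg]; exact h1)).mono ?_
    simp only [List.length_cons]
    exact le_of_eq (by ring)

end Prog

/-! ### The replay of a coded machine as a function on stacks -/

/-- The symbol that is pushed where only the height of the stack matters. -/
abbrev mark : Sym := .tok .pad

/-- The bit that is read from the top of a stack. -/
def isOne : Option Sym → Bool
  | some (.bit true) => true
  | _ => false

namespace Core

def pushBit (c : Core) : Bool → Bool → Core
  | true, b => { c with L := .bit b :: c.L }
  | false, b => { c with R := .bit b :: c.R }

/-- A mismatch is recorded on `F` instead of stopping the replay. An empty stack reads as `false`,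
which is the blank of the replayed tapes. -/
def popBit (c : Core) : Bool → Bool → Core
  | true, b => { c with L := c.L.tail, F := if isOne c.L.head? = b then c.F else mark :: c.F }
  | false, b => { c with R := c.R.tail, F := if isOne c.R.head? = b then c.F else mark :: c.F }

/-- The effect of a token of the code of a machine: `rule` reads a bit that tells whether the
following operations are executed. -/
def step (c : Core) : Sym → Core
  | .tok .rule =>
    match c.U with
    | [] => { c with A := c.A.tail }
    | b :: u => { c with
        A := if b = .bit true then b :: c.A.tail else c.A.tail
        U := u
        U2 := b :: c.U2 }
  | .tok (.push l b) => if c.A = [] then c else c.pushBit l b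
  | .tok (.pop l b) => if c.A = [] then c else c.popBit l b
  | _ => c

/-- The effect of a pass over a section of the code. -/
def pass (sec : List Sym) (c : Core) : Core :=
  sec.foldl step c

/-- The effect of a section of the code. -/
def runSection (sec : List Sym) (c : Core) : Core :=
  let d := (pass sec)^[c.U.length] c
  ⟨[], c.U, [], [], [], if isOne d.L.head? then d.F else mark :: d.F⟩

/-- The effect of a symbol of the code; the first component holds the part of the section that has
been read. -/
def codeStep (p : List Sym × Core) (a : Sym) : List Sym × Core :=
  if a = .tok .endSection then ([], runSection p.1.reverse p.2) else (a :: p.1, p.2)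

/-- The verdict on the witness `u` for the input that is given by the stack `r`: it is empty if
the witness is right. -/
def verdict (code r u : List Sym) : List Sym :=
  (code.foldl codeStep ([], ⟨[], u, [], [], r, []⟩)).2.F

/-- The bounds that are kept during the replay of a section. -/
structure Inv (c : Core) (u : List Sym) (n : ℕ) : Prop where
  A : c.A.length ≤ 1
  U : c.U2.reverse ++ c.U = u
  LR : c.L.length + c.R.length ≤ n

/-- A `rule` token clears the flag before it may set it anew, and moves at most one witness bit from
`U` to `U2`; every token adds at most one symbol to `L` and `R`. -/
theorem Inv.step {c : Core} {u : List Sym} {n : ℕ} (h : c.Inv u n) (a : Sym) :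
    (c.step a).Inv u (n + 1) := by
  have hA := h.A
  have hU := h.U
  have hLR := h.LR
  unfold Core.step
  split
  · split
    · exact ⟨by simp; omega, hU, by simp; omega⟩
    · next b u' hb =>
      refine ⟨?_, ?_, by simp; omega⟩
      · simp only
        split <;> simp <;> omega
      · simp [← hU, hb]
  · next l b =>
    split
    · exact ⟨hA, hU, by omega⟩
    · cases l <;> exact ⟨hA, hU, by simp [pushBit]; omega⟩
  · next l b =>
    split
    · exact ⟨hA, hU, by omega⟩
    · cases l <;> exact ⟨hA, hU, by simp [popBit]; omega⟩
  · exact ⟨hA, hU, by omega⟩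

theorem Inv.pass {c : Core} {u : List Sym} {n : ℕ} (h : c.Inv u n) (sec : List Sym) :
    (c.pass sec).Inv u (n + sec.length) := by
  induction sec generalizing c n with
  | nil => exact h
  | cons a l ih =>
    have := ih (h.step a)
    rw [List.length_cons, Nat.add_comm l.length, ← Nat.add_assoc]
    exact this

theorem Inv.passes {c : Core} {u : List Sym} {n : ℕ} (h : c.Inv u n) (sec : List Sym) (k : ℕ) :
    ((Core.pass sec)^[k] c).Inv u (n + k * sec.length) := by
  induction k generalizing c n with
  | zero => simpa using h
  | succ k ih =>
    rw [Function.iterate_succ_apply]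
    have := ih (h.pass sec)
    rwa [Nat.add_assoc, show sec.length + k * sec.length = (k + 1) * sec.length by ring] at this

end Core

/-! ### Programs for the replay and their running time -/

namespace Prog

/-- Run `p` if the current rule is to be applied. -/
def ifActive (p : Prog) : Prog :=
  pop .A fun o => match o with
    | none => skip
    | some a => seq (push .A a) p

/-- The stack to the left or to the right of the head of a replayed tape. -/
def side : Bool → Stk
  | true => .L
  | false => .R

/-- Mark the current rule as one to be applied if the bit `b` is set. -/
def activateIf (b : Sym) : Prog := if b = .bit true then push .A b else skip

theorem spec_activateIf (b : Sym) (s : Store) :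
    Spec (activateIf b) s {s.set .A (if b = .bit true then b :: s.get .A else s.get .A)} 3 := by
  unfold activateIf
  split_ifs
  · exact spec_push _ _ _
  · exact (spec_skip _).mono (by omega)

/-- Record a failure unless `c` holds. -/
def check (c : Prop) [Decidable c] : Prog := if c then skip else push .F mark

theorem spec_check (c : Prop) [Decidable c] (s : Store) :
    Spec (check c) s {s.set .F (if c then s.get .F else mark :: s.get .F)} 3 := by
  unfold check
  split_ifs
  · exact (spec_skip _).mono (by omega)
  · exact spec_push _ _ _

/-- The program that performs `Core.step`. -/
def tokProg : Sym → Prog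
  | .tok .rule => pop .A fun _ => pop .U fun o => match o with
    | none => skip
    | some b => seq (push .U2 b) (activateIf b)
  | .tok (.push l b) => ifActive (push (side l) (.bit b))
  | .tok (.pop l b) => ifActive (pop (side l) fun o => check (isOne o = b))
  | _ => skip

/-- The flag can be inspected only by popping it, so it is pushed back before `p` is run. -/
theorem spec_ifActive {p : Prog} {s s' : Store} {t : ℕ} (h : Spec p s {s'} t) (ht : 0 < t) :
    Spec (ifActive p) s {if s.core.A = [] then s else s'} (t + 5) := by
  refine Spec.mono (t := t + 4 + 1) (spec_pop ?_) (by omega)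
  obtain ⟨_, _, _, _, _, _, _, _, _, _, _, _, _, _, _, ⟨A, _, _, _, _, _⟩⟩ := s
  cases A with
  | nil => exact (spec_skip _).mono (by omega)
  | cons a l => exact (spec_then (spec_push _ .A a) h).mono (by omega)

theorem spec_tokProg (a : Sym) (s : Store) :
    Spec (tokProg a) s {{ s with core := s.core.step a }} 12 := by
  have hdef : Spec skip s {s} 12 := (spec_skip s).mono (by omega)
  rcases a with b | t
  · exact hdef
  cases t with
  | rule =>
    refine Spec.mono (t := 8 + 1 + 1) (spec_pop (spec_pop ?_)) (by omega)
    obtain ⟨_, _, _, _, _, _, _, _, _, _, _, _, _, _, _, ⟨A, U, _, _, _, _⟩⟩ := s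
    cases U with
    | nil => exact (spec_skip _).mono (by omega)
    | cons b u =>
      exact (spec_then (spec_push _ .U2 b) (spec_activateIf b _)).mono (by omega)
  | push l b =>
    refine (spec_ifActive (spec_push s (side l) (.bit b)) (by omega)).congr ?_ (by omega)
    cases l <;> simp only [Core.step] <;> split_ifs <;> rfl
  | pop l b =>
    have h : Spec (pop (side l) fun o => check (isOne o = b)) s
        {{ s with core := s.core.popBit l b }} 4 := by
      cases l <;> exact spec_pop (spec_check _ _)
    refine (spec_ifActive h (by omega)).congr ?_ (by omega)
    simp only [Core.step]
    split_ifs <;> rfl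
  | _ => exact hdef

/-- A pass over the section that is held by the stack `S`. -/
def passProg : Prog :=
  seq (loop .S fun a => seq (push .S2 a) (tokProg a)) (mv .S2 .S)

theorem spec_passProg {s : Store} (hs : s.S2 = []) :
    Spec passProg s {{ s with core := s.core.pass s.S }} (21 * s.S.length + 3) := by
  have h1 := spec_loop_foldl (i := .S) (f := fun a => seq (push .S2 a) (tokProg a))
    (g := fun a s => { s with S2 := a :: s.S2, core := s.core.step a })
    (fun a s => spec_then (spec_push s .S2 a) (spec_tokProg a _)) (fun _ _ _ => rfl) s
  have h2 : ∀ (l : List Sym) (s : Store),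
      l.foldl (fun s a => { s with S2 := a :: s.S2, core := s.core.step a }) s =
        { s with S2 := l.reverse ++ s.S2, core := s.core.pass l } := by
    intro l
    induction l with
    | nil => intro s; rfl
    | cons a l ih => intro s; rw [List.foldl_cons, ih]; simp [Core.pass]
  rw [h2] at h1
  refine (spec_then h1 (spec_mv (i := .S2) (j := .S) (by decide) _)).congr ?_ ?_
  · simp [Store.get, Store.set, hs]
  · simp [Store.get, Store.set, hs]
    omega

theorem spec_passes {s : Store} (hs : s.S2 = []) :
    Spec (loop .T fun _ => passProg) s
      {{ s with T := [], core := (Core.pass s.S)^[s.T.length] s.core }}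
      ((21 * s.S.length + 4) * s.T.length + 1) := by
  generalize hl : s.T = l
  induction l generalizing s with
  | nil =>
    refine (spec_loop_nil (f := fun _ => passProg) (show s.get .T = [] from hl)).congr ?_ (by omega)
    cases s; simp_all
  | cons a l ih =>
    have h1 := ih (s := { s with T := l, core := s.core.pass s.S }) hs rfl
    refine (spec_loop_cons (show s.get .T = a :: l from hl)
      (spec_passProg (s := { s with T := l }) hs) h1).mono ?_
    simp only [List.length_cons]
    exact le_of_eq (by ring)

/-- The program that performs `Core.runSection`. -/
def sectionProg : Prog :=
  seq (dup .U .U2 .T) <| seq (mv .U2 .U) <| seq (mv .S2 .S) <| seq (loop .T fun _ => passProg) <|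
  seq (clear .S) <| seq (mv .U .U2) <| seq (mv .U2 .U) <| seq (pop .A fun _ => skip) <|
  seq (pop .L fun o => check (isOne o)) <| seq (clear .L) (clear .R)

/-- There is one pass for each bit of the witness, each linear in the length of the section. The two
stacks of the tape grow by at most one symbol per token, so clearing them costs no more than the
passes and the initial contents. -/
theorem spec_sectionProg {s : Store} {n : ℕ} (hS : s.S = []) (hT : s.T = []) (hA : s.core.A = [])
    (hU2 : s.core.U2 = []) (hn : s.core.L.length + s.core.R.length ≤ n) :
    Spec sectionProg s {{ s with S2 := [], core := s.core.runSection s.S2.reverse }}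
      (60 * (s.core.U.length + 1) * (s.S2.length + 1) + 2 * n) := by
  obtain ⟨X, W, W2, Y, Y2, G, D, P, P2, C0, C1, C, S, S2, T, ⟨A, U, U2, L, R, F⟩⟩ := s
  simp only at hS hT hA hU2 hn ⊢
  subst hS hT hA hU2
  set c : Core := ⟨[], U, [], L, R, F⟩ with hc
  set d := (Core.pass S2.reverse)^[U.length] c with hd
  have hinv : d.Inv U (n + U.length * S2.length) := by
    have := Core.Inv.passes (c := c) (u := U) (n := n) ⟨by simp [hc], by simp [hc], hn⟩ S2.reverse
      U.length
    simpa using this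
  -- The stack `A` never holds more than one symbol, so a single pop clears it.
  have hdA : d.A.tail = [] := List.eq_nil_of_length_eq_zero (by have := hinv.A; simp; omega)
  have hUU : U.length = d.U2.length + d.U.length := by
    have := congrArg List.length hinv.U
    simpa using this.symm
  have hLR := hinv.LR
  have e1 := spec_dup (i := .U) (j := .U2) (k := .T) (by decide) (by decide) (by decide)
    ⟨X, W, W2, Y, Y2, G, D, P, P2, C0, C1, C, [], S2, [], c⟩
  have e2 := spec_mv (i := .U2) (j := .U) (by decide)
    ⟨X, W, W2, Y, Y2, G, D, P, P2, C0, C1, C, [], S2, U.reverse ++ [], ⟨[], [], U.reverse ++ [], L, R, F⟩⟩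
  have e3 := spec_mv (i := .S2) (j := .S) (by decide)
    ⟨X, W, W2, Y, Y2, G, D, P, P2, C0, C1, C, [], S2, U.reverse ++ [],
      ⟨[], (U.reverse ++ []).reverse ++ [], [], L, R, F⟩⟩
  have e4 := spec_passes (s := ⟨X, W, W2, Y, Y2, G, D, P, P2, C0, C1, C, S2.reverse ++ [], [],
    U.reverse ++ [], ⟨[], (U.reverse ++ []).reverse ++ [], [], L, R, F⟩⟩) rfl
  have e4' : Spec (loop .T fun _ => passProg) ⟨X, W, W2, Y, Y2, G, D, P, P2, C0, C1, C,
      S2.reverse ++ [], [], U.reverse ++ [], ⟨[], (U.reverse ++ []).reverse ++ [], [], L, R, F⟩⟩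
      {⟨X, W, W2, Y, Y2, G, D, P, P2, C0, C1, C, S2.reverse, [], [], d⟩}
      ((21 * S2.length + 4) * U.length + 1) := by
    refine e4.congr ?_ ?_
    · simp [hd, hc]
    · simp
  have e5 := spec_clear .S ⟨X, W, W2, Y, Y2, G, D, P, P2, C0, C1, C, S2.reverse, [], [], d⟩
  -- Moving the unread witness bits onto the read ones yields the whole witness reversed; moving all
  -- back restores it for the next section.
  have e6 := spec_mv (i := .U) (j := .U2) (by decide)
    ⟨X, W, W2, Y, Y2, G, D, P, P2, C0, C1, C, [], [], [], d⟩
  have e7 := spec_mv (i := .U2) (j := .U) (by decide)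
    ⟨X, W, W2, Y, Y2, G, D, P, P2, C0, C1, C, [], [], [],
      ⟨d.A, [], d.U.reverse ++ d.U2, d.L, d.R, d.F⟩⟩
  have e8 : Spec (pop .A fun _ => skip) ⟨X, W, W2, Y, Y2, G, D, P, P2, C0, C1, C, [], [], [],
      ⟨d.A, (d.U.reverse ++ d.U2).reverse ++ [], [], d.L, d.R, d.F⟩⟩
      {⟨X, W, W2, Y, Y2, G, D, P, P2, C0, C1, C, [], [], [], ⟨[], U, [], d.L, d.R, d.F⟩⟩} 2 := by
    refine spec_pop ?_
    refine (spec_skip _).congr ?_ le_rfl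
    simp only [Store.set, Store.get, hdA]
    simp [hinv.U]
  have e9 : Spec (pop .L fun o => check (isOne o))
      ⟨X, W, W2, Y, Y2, G, D, P, P2, C0, C1, C, [], [], [], ⟨[], U, [], d.L, d.R, d.F⟩⟩
      {⟨X, W, W2, Y, Y2, G, D, P, P2, C0, C1, C, [], [], [], ⟨[], U, [], d.L.tail, d.R,
        if isOne d.L.head? then d.F else mark :: d.F⟩⟩} 4 := by
    exact spec_pop (spec_check _ _)
  have e10 := spec_clear .L ⟨X, W, W2, Y, Y2, G, D, P, P2, C0, C1, C, [], [], [],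
    ⟨[], U, [], d.L.tail, d.R, if isOne d.L.head? then d.F else mark :: d.F⟩⟩
  have e11 := spec_clear .R ⟨X, W, W2, Y, Y2, G, D, P, P2, C0, C1, C, [], [], [],
    ⟨[], U, [], [], d.R, if isOne d.L.head? then d.F else mark :: d.F⟩⟩
  refine (spec_then e1 <| spec_then e2 <| spec_then e3 <| spec_then e4' <| spec_then e5 <|
    spec_then e6 <| spec_then e7 <| spec_then e8 <| spec_then e9 <| spec_then e10 e11).mono ?_
  simp only [Store.get, List.append_nil, List.length_reverse, List.length_append,
    List.length_tail, hc]
  nlinarith [Nat.zero_le (U.length * S2.length), Nat.sub_le d.L.length 1]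

end Prog

namespace Core

/-- The bounds that are kept between the sections. -/
structure Rest (c : Core) (u : List Sym) (n : ℕ) : Prop where
  A : c.A = []
  U : c.U = u
  U2 : c.U2 = []
  LR : c.L.length + c.R.length ≤ n

/-- Each section leaves the witness as it was, so that all sections replay the same history. -/
theorem Rest.codeStep {p : List Sym × Core} {u : List Sym} {n : ℕ} (h : p.2.Rest u n) (a : Sym) :
    (codeStep p a).2.Rest u n := by
  unfold Core.codeStep
  split_ifs
  · exact ⟨rfl, h.U, rfl, Nat.zero_le _⟩
  · exact h

theorem Rest.foldl {p : List Sym × Core} {u : List Sym} {n : ℕ} (h : p.2.Rest u n)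
    (l : List Sym) : (l.foldl Core.codeStep p).2.Rest u n := by
  induction l generalizing p with
  | nil => exact h
  | cons a l ih => exact ih (h.codeStep a)

theorem length_codeStep (p : List Sym × Core) (a : Sym) :
    (codeStep p a).1.length ≤ p.1.length + 1 := by
  unfold codeStep
  split_ifs <;> simp

theorem length_foldl_codeStep (l : List Sym) (p : List Sym × Core) :
    (l.foldl codeStep p).1.length ≤ p.1.length + l.length := by
  induction l generalizing p with
  | nil => simp
  | cons a l ih =>
    have h1 := ih (codeStep p a)
    have h2 := length_codeStep p a
    simp only [List.foldl_cons, List.length_cons]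
    omega

end Core

namespace Prog

/-- The loop over the code that performs `Core.codeStep` for each symbol. -/
def codeProg : Prog :=
  loop .C fun a => if a = .tok .endSection then sectionProg else push .S2 a

theorem spec_codeProg {s : Store} {u : List Sym} {n m : ℕ} (hS : s.S = []) (hT : s.T = [])
    (h : s.core.Rest u n) (hm : s.S2.length + s.C.length ≤ m) :
    Spec codeProg s {{ s with
      C := []
      S2 := (s.C.foldl Core.codeStep (s.S2, s.core)).1
      core := (s.C.foldl Core.codeStep (s.S2, s.core)).2 }}
      ((60 * (u.length + 1) * (m + 1) + 2 * n + 4) * s.C.length + 1) := by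
  generalize hl : s.C = l
  induction l generalizing s with
  | nil =>
    refine (spec_loop_nil (show s.get .C = [] from hl)).congr ?_ (by omega)
    cases s; simp_all
  | cons a l ih =>
    have hstep : Spec (if a = .tok .endSection then sectionProg else push .S2 a) (s.set .C l)
        {{ s with
          C := l
          S2 := (Core.codeStep (s.S2, s.core) a).1
          core := (Core.codeStep (s.S2, s.core) a).2 }}
        (60 * (u.length + 1) * (m + 1) + 2 * n + 3) := by
      simp only [Core.codeStep]
      split_ifs
      · refine (spec_sectionProg (s := s.set .C l) hS hT h.A h.U2 h.LR).mono ?_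
        have h1 : s.S2.length ≤ m := by omega
        have h2 : s.core.U.length = u.length := by rw [h.U]
        simp only [Store.set, h2]
        have := Nat.mul_le_mul_left (60 * (u.length + 1)) (Nat.succ_le_succ h1)
        simp only [Nat.succ_eq_add_one] at this
        omega
      · exact (spec_push _ _ _).mono (by omega)
    have h1 := ih (s := { s with
          C := l
          S2 := (Core.codeStep (s.S2, s.core) a).1
          core := (Core.codeStep (s.S2, s.core) a).2 }) hS hT (h.codeStep a)
          (by
            have := Core.length_codeStep (s.S2, s.core) a
            simp only [hl, List.length_cons] at hm this ⊢
            omega) rfl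
    refine (spec_loop_cons (show s.get .C = a :: l from hl) hstep h1).mono ?_
    simp only [List.length_cons]
    exact le_of_eq (by ring)

/-- Compute the verdict on the witness in the stack `U` for the input in the stack `R`. -/
def verifyProg : Prog :=
  seq (dup .C0 .C .C1) <| seq (mv .C1 .C0) <| seq codeProg <| seq (clear .S2) <|
  seq (clear .U) <| seq (clear .L) (clear .R)

/-- The code is kept on `C0`, last token on top, and survives the verification; all working stacks
are empty afterwards, so that the program can be run again. -/
theorem spec_verifyProg (X W W2 Y Y2 G D P P2 C0 u r : List Sym) :
    Spec verifyProg ⟨X, W, W2, Y, Y2, G, D, P, P2, C0, [], [], [], [], [], ⟨[], u, [], [], r, []⟩⟩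
      {⟨X, W, W2, Y, Y2, G, D, P, P2, C0, [], [], [], [], [],
        ⟨[], [], [], [], [], Core.verdict C0.reverse r u⟩⟩}
      (100 * (u.length + 1) * (C0.length + 1) * (C0.length + 1) * (r.length + 1)) := by
  have e1 := spec_dup (i := .C0) (j := .C) (k := .C1) (by decide) (by decide) (by decide)
    ⟨X, W, W2, Y, Y2, G, D, P, P2, C0, [], [], [], [], [], ⟨[], u, [], [], r, []⟩⟩
  have e2 := spec_mv (i := .C1) (j := .C0) (by decide)
    ⟨X, W, W2, Y, Y2, G, D, P, P2, [], C0.reverse ++ [], C0.reverse ++ [], [], [], [],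
      ⟨[], u, [], [], r, []⟩⟩
  have hrest : Core.Rest ⟨[], u, [], [], r, []⟩ u r.length := ⟨rfl, rfl, rfl, by simp⟩
  have e3 := spec_codeProg (u := u) (n := r.length) (m := C0.length)
    (s := ⟨X, W, W2, Y, Y2, G, D, P, P2, (C0.reverse ++ []).reverse ++ [], [], C0.reverse ++ [],
      [], [], [], ⟨[], u, [], [], r, []⟩⟩) rfl rfl hrest (by simp)
  simp only [List.append_nil, List.reverse_reverse] at e3
  set p := C0.reverse.foldl Core.codeStep ([], ⟨[], u, [], [], r, []⟩) with hp
  have hprest : p.2.Rest u r.length := Core.Rest.foldl hrest _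
  have hlen : p.1.length ≤ C0.length := by
    have := Core.length_foldl_codeStep C0.reverse ([], ⟨[], u, [], [], r, []⟩)
    rwa [← hp, List.length_reverse, List.length_nil, Nat.zero_add] at this
  have e4 := spec_clear .S2 ⟨X, W, W2, Y, Y2, G, D, P, P2, C0, [], [], [], p.1, [], p.2⟩
  have e5 := spec_clear .U ⟨X, W, W2, Y, Y2, G, D, P, P2, C0, [], [], [], [], [], p.2⟩
  have e6 := spec_clear .L ⟨X, W, W2, Y, Y2, G, D, P, P2, C0, [], [], [], [], [],
    { p.2 with U := [] }⟩
  have e7 := spec_clear .R ⟨X, W, W2, Y, Y2, G, D, P, P2, C0, [], [], [], [], [],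
    { p.2 with U := [], L := [] }⟩
  have e2' := e2.congr (s₂ := ⟨X, W, W2, Y, Y2, G, D, P, P2, C0, [], C0.reverse, [], [], [],
      ⟨[], u, [], [], r, []⟩⟩) (by simp [Store.set, Store.get]) le_rfl
  refine (spec_then e1 <| spec_then e2' <| spec_then e3 <| spec_then e4 <| spec_then e5 <|
    spec_then e6 e7).congr ?_ ?_
  · simp only [Store.set, Core.verdict, ← hp, hprest.A, hprest.U2]
  · have h1 := hprest.LR
    have h2 : p.2.U.length = u.length := by rw [hprest.U]
    simp only [Store.get, List.append_nil, List.length_reverse, h2]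
    generalize C0.length = c at *
    generalize u.length = a at *
    generalize r.length = n at *
    refine le_trans (b := 8 * c + 1 + (4 * c + 1 + ((60 * (a + 1) * (c + 1) + 2 * n + 4) * c + 1 +
      (2 * c + 1 + (2 * a + 1 + (2 * n + 1 + (2 * n + 1) + 1) + 1) + 1) + 1) + 1) + 1) ?_ ?_
    · omega
    · ring_nf
      omega

/-- The stack of the bits of an input that are pushed one by one on the stack `r`, each of them
coded by itself and the bit `true`. -/
def loadBits (l r : List Sym) : List Sym :=
  l.foldl (fun r b => .bit true :: b :: r) r

theorem length_loadBits (l r : List Sym) : (loadBits l r).length = 2 * l.length + r.length := by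
  unfold loadBits
  induction l generalizing r with
  | nil => simp
  | cons a l ih => rw [List.foldl_cons, ih]; simp; omega

/-- Load the bits in the stack `i` to the stack `R`, and push as many symbols on the stack `D`. -/
def loadProg (i j : Stk) : Prog :=
  seq (loop i fun b => seq (push .R b) <| seq (push .R (.bit true)) <| seq (push j b)
    (push .D mark)) (mv j i)

theorem spec_loadProg_Y {s : Store} (h : s.Y2 = []) :
    Spec (loadProg .Y .Y2) s {{ s with
      D := List.replicate s.Y.length mark ++ s.D
      core := { s.core with R := loadBits s.Y s.core.R } }} (20 * s.Y.length + 3) := by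
  have h1 := spec_loop_foldl (i := .Y) (f := fun b => seq (push .R b) <|
      seq (push .R (.bit true)) <| seq (push .Y2 b) (push .D mark))
    (g := fun b s => { s with
      Y2 := b :: s.Y2
      D := mark :: s.D
      core := { s.core with R := .bit true :: b :: s.core.R } })
    (fun a s => spec_then (spec_push s .R a) (spec_then (spec_push _ _ _)
      (spec_then (spec_push _ _ _) (spec_push _ _ _)))) (fun _ _ _ => rfl) s
  have h2 : ∀ (l : List Sym) (s : Store), l.foldl (fun s b => { s with
      Y2 := b :: s.Y2
      D := mark :: s.D
      core := { s.core with R := .bit true :: b :: s.core.R } }) s = { s with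
      Y2 := l.reverse ++ s.Y2
      D := List.replicate l.length mark ++ s.D
      core := { s.core with R := loadBits l s.core.R } } := by
    intro l
    induction l with
    | nil => intro s; rfl
    | cons a l ih =>
      intro s
      rw [List.foldl_cons, ih, List.length_cons, List.replicate_succ']
      simp [loadBits]
  rw [h2] at h1
  refine (spec_then h1 (spec_mv (i := .Y2) (j := .Y) (by decide) _)).congr ?_ ?_
  · simp [Store.get, Store.set, h]
  · simp [Store.get, Store.set, h]
    omega

theorem spec_loadProg_W {s : Store} (h : s.W2 = []) :
    Spec (loadProg .W .W2) s {{ s with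
      D := List.replicate s.W.length mark ++ s.D
      core := { s.core with R := loadBits s.W s.core.R } }} (20 * s.W.length + 3) := by
  have h1 := spec_loop_foldl (i := .W) (f := fun b => seq (push .R b) <|
      seq (push .R (.bit true)) <| seq (push .W2 b) (push .D mark))
    (g := fun b s => { s with
      W2 := b :: s.W2
      D := mark :: s.D
      core := { s.core with R := .bit true :: b :: s.core.R } })
    (fun a s => spec_then (spec_push s .R a) (spec_then (spec_push _ _ _)
      (spec_then (spec_push _ _ _) (spec_push _ _ _)))) (fun _ _ _ => rfl) s
  have h2 : ∀ (l : List Sym) (s : Store), l.foldl (fun s b => { s with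
      W2 := b :: s.W2
      D := mark :: s.D
      core := { s.core with R := .bit true :: b :: s.core.R } }) s = { s with
      W2 := l.reverse ++ s.W2
      D := List.replicate l.length mark ++ s.D
      core := { s.core with R := loadBits l s.core.R } } := by
    intro l
    induction l with
    | nil => intro s; rfl
    | cons a l ih =>
      intro s
      rw [List.foldl_cons, ih, List.length_cons, List.replicate_succ']
      simp [loadBits]
  rw [h2] at h1
  refine (spec_then h1 (spec_mv (i := .W2) (j := .W) (by decide) _)).congr ?_ ?_
  · simp [Store.get, Store.set, h]
  · simp [Store.get, Store.set, h]
    omega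

/-- Double the height of the stack `P` for each symbol of the stack `D`. -/
def doubleProg : Prog :=
  loop .D fun _ => seq (loop .P fun _ => seq (push .P2 mark) (push .P2 mark)) (mv .P2 .P)

/-- The height of `P` is a number in unary; each symbol of `D` doubles it by way of `P2`. -/
theorem spec_doubleProg {s : Store} {k : ℕ} (hP : s.P = List.replicate k mark)
    (hP2 : s.P2 = []) :
    Spec doubleProg s {{ s with D := [], P := List.replicate (k * 2 ^ s.D.length) mark }}
      ((16 * (k * 2 ^ s.D.length) + 4) * s.D.length + 1) := by
  generalize hl : s.D = l
  induction l generalizing s k with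
  | nil =>
    refine (spec_loop_nil (show s.get .D = [] from hl)).congr ?_ (by omega)
    cases s; simp_all
  | cons a l ih =>
    have h1 := spec_loop_foldl (i := .P) (f := fun _ => seq (push .P2 mark) (push .P2 mark))
      (g := fun _ s => { s with P2 := mark :: mark :: s.P2 })
      (fun a s => spec_then (spec_push s _ _) (spec_push _ _ _)) (fun _ _ _ => rfl)
      { s with D := l }
    have h2 : ∀ (l : List Sym) (s : Store),
        l.foldl (fun s _ => { s with P2 := mark :: mark :: s.P2 }) s =
          { s with P2 := List.replicate (2 * l.length) mark ++ s.P2 } := by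
      intro l
      induction l with
      | nil => intro s; rfl
      | cons a l ih =>
        intro s
        rw [List.foldl_cons, ih, List.length_cons, Nat.mul_succ, List.replicate_add]
        simp
    rw [h2] at h1
    have h3 := (spec_then h1 (spec_mv (i := .P2) (j := .P) (by decide) _)).congr
      (s₂ := { s with D := l, P := List.replicate (2 * k) mark }) (t' := 16 * k + 3)
      (by simp [Store.get, Store.set, hP, hP2]) (by simp [Store.get, Store.set, hP, hP2]; omega)
    have h4 := ih (s := { s with D := l, P := List.replicate (2 * k) mark }) (k := 2 * k) rfl hP2
      rfl
    refine (spec_loop_cons (show s.get .D = a :: l from hl) h3 h4).congr ?_ ?_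
    · simp only [List.length_cons, pow_succ]
      rw [show 2 * k * 2 ^ l.length = k * (2 ^ l.length * 2) by ring]
    · simp only [List.length_cons, pow_succ]
      have : k ≤ k * 2 ^ l.length := Nat.le_mul_of_pos_right _ (by positivity)
      generalize 2 ^ l.length = q at *
      have h5 : k * q * 0 = 0 := by ring
      nlinarith [Nat.zero_le (k * q * l.length)]

/-- Guess a bit for each symbol of the stack `P`. -/
def guessProg : Prog :=
  loop .P fun _ => choice (push .U (.bit false)) (push .U (.bit true))

theorem spec_guessProg (s : Store) :
    Spec guessProg s {s' | ∃ v : List Bool, v.length = s.P.length ∧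
      s' = { s with P := [], core := { s.core with U := v.map .bit ++ s.core.U } }}
      (5 * s.P.length + 1) := by
  generalize hl : s.P = l
  induction l generalizing s with
  | nil =>
    have h := spec_loop_nil (f := fun _ => choice (push .U (.bit false)) (push .U (.bit true)))
      (show s.get .P = [] from hl)
    refine h.congr_set (fun s' => ?_) (by omega)
    simp only [List.length_nil, List.length_eq_zero_iff, exists_eq_left, Set.mem_ofPred_eq,
      List.map_nil, List.nil_append, Set.mem_singleton_iff]
    rw [← hl]
  | cons a l ih =>
    have h1 : ∀ b : Bool, Spec (push .U (.bit b)) (s.set .P l)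
        {{ s with P := l, core := { s.core with U := .bit b :: s.core.U } }} 3 :=
      fun b => spec_push _ _ _
    have h2 : ∀ b : Bool, _ := fun b =>
      ih { s with P := l, core := { s.core with U := .bit b :: s.core.U } } rfl
    refine (spec_loop_cons' (show s.get .P = a :: l from hl) (spec_choice (h1 false) (h1 true))
      (F := fun s => {s' | ∃ v : List Bool, v.length = l.length ∧
        s' = { s with P := [], core := { s.core with U := v.map .bit ++ s.core.U } }})
      (by rintro _ (rfl | rfl); exacts [h2 false, h2 true]) ?_).mono
      (by simp only [List.length_cons]; omega)
    ext s'
    simp only [List.length_cons, Set.mem_ofPred_eq, Set.mem_iUnion, Set.mem_union,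
      Set.mem_singleton_iff]
    constructor
    · rintro ⟨v, hv, rfl⟩
      -- The bit that is guessed first lies deepest on the stack, so it is the last one of the
      -- guessed word.
      obtain ⟨v, b, rfl⟩ : ∃ v' b, v = v' ++ [b] := by
        rcases List.eq_nil_or_concat v with rfl | ⟨v', b, rfl⟩
        · simp at hv
        · exact ⟨v', b, by simp⟩
      refine ⟨{ s with P := l, core := { s.core with U := .bit b :: s.core.U } }, ?_, v, by simpa using hv, ?_⟩
      · cases b <;> simp
      · simp
    · rintro ⟨s'', (rfl | rfl), v, hv, rfl⟩
      · exact ⟨v ++ [false], by simp [hv], by simp⟩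
      · exact ⟨v ++ [true], by simp [hv], by simp⟩

end Prog

/-! ### The format of the inputs and the accepted inputs -/

/-- The token that is coded by four bits. -/
def decode : Bool → Bool → Bool → Bool → Tok
  | false, true, l, b => .push l b
  | false, false, l, b => .pop l b
  | true, false, false, false => .rule
  | true, false, false, true => .endSection
  | true, false, true, false => .endCode
  | true, false, true, true => .double
  | true, true, _, _ => .pad

/-- Split an input into the part up to the token `endCode` and the rest. The rest is returned,
followed by the stacks of the bits of the first part, of the tokens `double`, and of the other
tokens. -/
def parse : List Bool → List Sym → List Sym → List Sym →
    Option (List Bool × List Sym × List Sym × List Sym)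
  | b₁ :: b₂ :: b₃ :: b₄ :: x, W, D, C =>
    let W' := .bit b₄ :: .bit b₃ :: .bit b₂ :: .bit b₁ :: W
    let t := decode b₁ b₂ b₃ b₄
    if t = .endCode then some (x, W', D, C)
    else if t = .double then parse x W' (mark :: D) C
    else parse x W' D (.tok t :: C)
  | _, _, _, _ => none

/-- All stacks that are filled while the input is read are bounded by the length of the input, which
the time bounds need. -/
theorem length_of_parse {x : List Bool} {W D C : List Sym}
    {r : List Bool × List Sym × List Sym × List Sym} (h : parse x W D C = some r) :
    r.2.1.length + r.1.length = W.length + x.length ∧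
      r.2.2.1.length + r.2.2.2.length ≤ D.length + C.length + x.length := by
  induction x, W, D, C using parse.induct with
  | case1 b₁ b₂ b₃ b₄ x W D C t ht =>
    rw [parse, if_pos ht] at h
    obtain rfl := Option.some.inj h
    simp
    omega
  | case2 b₁ b₂ b₃ b₄ x W D C W' t ht ht' ih =>
    rw [parse, if_neg ht, if_pos ht'] at h
    have := ih h
    simp only [List.length_cons, W'] at this ⊢
    omega
  | case3 b₁ b₂ b₃ b₄ x W D C W' t ht ht' ih =>
    rw [parse, if_neg ht, if_neg ht'] at h
    have := ih h
    simp only [List.length_cons, W'] at this ⊢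
    omega
  | case4 x W D C hx =>
    rw [parse] at h
    · cases h
    · exact hx

/-- The inputs that the universal machine accepts. -/
def Accepted (x : List Bool) : Prop :=
  ∃ r, parse x [] [] [] = some r ∧
    if 2 ^ r.2.2.1.length ≤ r.1.length then
      Core.verdict r.2.2.2.reverse (Prog.loadBits r.2.1 []) (r.1.map .bit) ≠ []
    else ∀ b : Bool, ∃ v : List Bool, v.length = 2 ^ x.length ∧
      Core.verdict r.2.2.2.reverse (Prog.loadBits r.2.1
        (Prog.loadBits (r.1.reverse.map .bit) [.bit true, .bit b])) (v.map .bit) = []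

/-! ### The stages of the universal machine -/

namespace Prog

/-- The store between the stages of the universal machine. -/
def base (X W Y D P C0 : List Sym) : Store :=
  ⟨X, W, [], Y, [], [], D, P, [], C0, [], [], [], [], [], ⟨[], [], [], [], [], []⟩⟩

/-- The set of a single store, or empty. -/
def guarded (p : Prop) (s : Store) : Set Store := {s' | s' = s ∧ p}

theorem guarded_true {p : Prop} (hp : p) (s : Store) : guarded p s = {s} := by
  ext; simp [guarded, hp]

theorem guarded_false {p : Prop} (hp : ¬ p) (s : Store) : guarded p s = ∅ := by
  ext; simp [guarded, hp]

/-- Continue if the verdict is positive. -/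
def requireProg : Prog := pop .F fun o => match o with
  | none => skip
  | some _ => fail

/-- Continue if the verdict is negative. -/
def refuteProg : Prog := pop .F fun o => match o with
  | none => fail
  | some _ => skip

theorem spec_requireProg (s : Store) :
    Spec requireProg s (guarded (s.core.F = []) s) 2 := by
  refine spec_pop ?_
  obtain ⟨_, _, _, _, _, _, _, _, _, _, _, _, _, _, _, ⟨_, _, _, _, _, F⟩⟩ := s
  cases F with
  | nil => rw [guarded_true rfl]; exact spec_skip _
  | cons a l => rw [guarded_false (by simp)]; exact spec_fail _

theorem spec_refuteProg (s : Store) :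
    Spec refuteProg s (guarded (s.core.F ≠ []) { s with core := { s.core with
      F := s.core.F.tail } }) 2 := by
  refine spec_pop ?_
  obtain ⟨_, _, _, _, _, _, _, _, _, _, _, _, _, _, _, ⟨_, _, _, _, _, F⟩⟩ := s
  cases F with
  | nil => rw [guarded_false (by simp)]; exact spec_fail _
  | cons a l => rw [guarded_true (by simp)]; exact spec_skip _

/-- Simulate the coded machine on the input followed by the bit `b`. -/
def simulateProg (b : Bool) : Prog :=
  seq (push .R (.bit b)) <| seq (push .R (.bit true)) <| seq (loadProg .Y .Y2) <|
  seq (loadProg .W .W2) <| seq (push .P mark) <| seq doubleProg <| seq guessProg <|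
  seq verifyProg requireProg

/-- All successful paths end in the store they started from, whatever was guessed, so two
simulations can be run one after the other. The four factors `N` stand for the witness, the code
twice, and the loaded input. -/
theorem spec_simulateProg (b : Bool) {W Y C0 : List Sym} {n N : ℕ}
    (hn : W.length + Y.length = n) (hC : C0.length ≤ n) (hN : N = 2 ^ n) :
    Spec (simulateProg b) (base [] W Y [] [] C0) (guarded
      (∃ v : List Bool, v.length = N ∧ Core.verdict C0.reverse (loadBits W
        (loadBits Y [.bit true, .bit b])) (v.map .bit) = []) (base [] W Y [] [] C0))
      (1000 * (N * N * N * N)) := by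
  set r := loadBits W (loadBits Y [.bit true, .bit b]) with hr
  have hrl : r.length = 2 * n + 2 := by
    rw [hr, length_loadBits, length_loadBits]; simp; omega
  have e1 := spec_push (base [] W Y [] [] C0) .R (.bit b)
  have e2 := spec_push ((base [] W Y [] [] C0).set .R [.bit b]) .R (.bit true)
  have e3 := spec_loadProg_Y (s := (base [] W Y [] [] C0).set .R [.bit true, .bit b]) rfl
  have e4 := spec_loadProg_W (s := (base [] W Y (List.replicate Y.length mark ++ []) [] C0).set .R
    (loadBits Y [.bit true, .bit b])) rfl
  -- Loading the input has left one mark on `D` for each of its bits, so that the doublings produce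
  -- the `2 ^ n` marks which are turned into guessed bits.
  have hD : List.replicate W.length mark ++ (List.replicate Y.length mark ++ []) =
      List.replicate n mark := by
    rw [List.append_nil, ← List.replicate_add, hn]
  replace e4 := e4.congr (s₂ := (base [] W Y (List.replicate n mark) [] C0).set .R r)
    (by rw [← hD]; rfl) le_rfl
  have e5 := spec_push ((base [] W Y (List.replicate n mark) [] C0).set .R r) .P mark
  have e6 := (spec_doubleProg (k := 1) (s := (base [] W Y (List.replicate n mark) [mark] C0).set .R
    r) rfl rfl).congr (s₂ := (base [] W Y [] (List.replicate N mark) C0).set .R r)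
    (t' := (16 * N + 4) * n + 1) (by simp [base, Store.set, hN]) (by simp [base, Store.set, hN])
  have e7 := spec_guessProg ((base [] W Y [] (List.replicate N mark) C0).set .R r)
  have e8 : ∀ s' ∈ {s' | ∃ v : List Bool,
      v.length = ((base [] W Y [] (List.replicate N mark) C0).set .R r).P.length ∧ s' =
        ⟨[], W, [], Y, [], [], [], [], [], C0, [], [], [], [], [],
          ⟨[], v.map .bit ++ [], [], [], r, []⟩⟩}, Spec (seq verifyProg requireProg) s'
        (guarded (Core.verdict C0.reverse r s'.core.U = []) (base [] W Y [] [] C0))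
        (100 * (N + 1) * (C0.length + 1) * (C0.length + 1) * (r.length + 1) + 3) := by
    rintro _ ⟨v, hv, rfl⟩
    have h1 := spec_verifyProg [] W [] Y [] [] [] [] [] C0 (v.map .bit ++ []) r
    have h2 := spec_requireProg (base [] W Y [] [] C0 |>.set .F
      (Core.verdict C0.reverse r (v.map .bit ++ [])))
    refine (spec_then h1 h2).congr_set (fun s' => ?_) ?_
    · simp only [guarded, Set.mem_ofPred_eq]
      refine and_congr_left fun h => ?_
      have h : Core.verdict C0.reverse r (v.map .bit ++ []) = [] := h
      rw [h]
      rfl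
    · have : v.length = N := by rw [hv]; simp [base, Store.set]
      simp [this]
  have e9 := spec_seq (R' := guarded
      (∃ v : List Bool, v.length = N ∧ Core.verdict C0.reverse r (v.map .bit) = [])
      (base [] W Y [] [] C0)) e7 e8 (by
    ext s'
    simp only [guarded, Set.mem_ofPred_eq, Set.mem_iUnion]
    constructor
    · rintro ⟨rfl, v, hv, h⟩
      exact ⟨_, ⟨v, by simpa [base, Store.set] using hv, rfl⟩, rfl, by
        simpa [base, Store.set] using h⟩
    · rintro ⟨_, ⟨v, hv, rfl⟩, rfl, h⟩
      exact ⟨rfl, v, by simpa [base, Store.set] using hv, by simpa [base, Store.set] using h⟩)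
  refine (spec_then e1 <| spec_then e2 <| spec_then e3 <| spec_then e4 <| spec_then e5 <|
    spec_then e6 e9).mono ?_
  have hnN : n + 1 ≤ N := hN ▸ Nat.lt_two_pow_self
  have hWn : W.length ≤ n := by omega
  have hYn : Y.length ≤ n := by omega
  simp only [Store.set, base, List.length_replicate, hrl]
  generalize C0.length = c at *
  generalize W.length = w at *
  generalize Y.length = y at *
  clear e1 e2 e3 e4 e5 e6 e7 e8 e9 hr hrl hD hN hn
  calc _ ≤ 3 + (3 + (20 * N + 3 + (20 * N + 3 + (3 + ((16 * N + 4) * N + 1 + (5 * N + 1 +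
        (100 * (N + N) * N * N * (2 * N + N) + 3) + 1) + 1) + 1) + 1) + 1) + 1) + 1 := by
        gcongr <;> omega
    _ = 600 * (N * N * N * N) + 16 * (N * N) + 49 * N + 27 := by ring
    _ ≤ _ := by
      have h1 : 1 ≤ N := by omega
      have h2 : N ≤ N * N := Nat.le_mul_of_pos_right _ h1
      have h3 : N * N ≤ N * N * N := Nat.le_mul_of_pos_right _ h1
      have h4 : N * N * N ≤ N * N * N * N := Nat.le_mul_of_pos_right _ h1
      omega

/-- Check that the coded machine does not accept the first part of the input with the second part
as its witness. -/
def diagonalProg : Prog :=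
  seq (mv .Y .U) <| seq (loadProg .W .W2) <| seq verifyProg refuteProg

theorem spec_diagonalProg {W Y C0 : List Sym} {n N : ℕ}
    (hn : W.length + Y.length = n) (hC : C0.length ≤ n) (hN : N = 2 ^ n) :
    ∃ s, Spec diagonalProg (base [] W Y [] [] C0) (guarded
      (Core.verdict C0.reverse (loadBits W []) Y.reverse ≠ []) s)
      (1000 * (N * N * N * N)) := by
  set r := loadBits W [] with hr
  have hrl : r.length = 2 * W.length := by
    rw [hr, length_loadBits]; simp
  have e1 := spec_mv (i := .Y) (j := .U) (by decide) (base [] W Y [] [] C0)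
  have e2 := spec_loadProg_W (s := (base [] W [] [] [] C0).set .U (Y.reverse ++ [])) rfl
  have e3 := spec_verifyProg [] W [] [] [] [] (List.replicate W.length mark ++ []) [] [] C0
    (Y.reverse ++ []) r
  have e4 := spec_refuteProg ((base [] W [] (List.replicate W.length mark ++ []) [] C0).set .F
    (Core.verdict C0.reverse r (Y.reverse ++ [])))
  refine ⟨(base [] W [] (List.replicate W.length mark ++ []) [] C0).set .F
    (Core.verdict C0.reverse r (Y.reverse ++ [])).tail, ?_⟩
  have e5 := spec_then e1 <| spec_then e2 <| spec_then e3 e4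
  have h1 : Core.verdict C0.reverse r Y.reverse = Core.verdict C0.reverse r (Y.reverse ++ []) := by
    rw [List.append_nil]
  rw [h1]
  refine e5.mono ?_
  have hnN : n + 1 ≤ N := hN ▸ Nat.lt_two_pow_self
  have hWn : W.length ≤ N := by omega
  have hYn : Y.length ≤ N := by omega
  simp only [Store.set, Store.get, base, List.length_append, List.length_nil, List.length_reverse,
    hrl]
  have hCN : C0.length + 1 ≤ N := by omega
  have hYn' : Y.length + 1 ≤ N := by omega
  generalize C0.length = c at *
  generalize W.length = w at *
  generalize Y.length = y at *
  clear e1 e2 e3 e4 e5 hr hrl hN hn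
  have h1 : 1 ≤ N := by omega
  calc _ ≤ 4 * N + 1 + (20 * N + 3 + (100 * (N + N) * N * N * (2 * N + N) + 2 + 1) + 1) + 1 := by
        gcongr
        omega
    _ = 600 * (N * N * N * N) + 24 * N + 9 := by ring
    _ ≤ _ := by
      have h2 : N ≤ N * N := Nat.le_mul_of_pos_right _ h1
      have h3 : N * N ≤ N * N * N := Nat.le_mul_of_pos_right _ h1
      have h4 : N * N * N ≤ N * N * N * N := Nat.le_mul_of_pos_right _ h1
      omega

/-- Decide by the number of the tokens `double` and the length of the rest of the input what is
simulated. -/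
def selectProg : Prog :=
  seq (push .P mark) <| seq doubleProg <|
  seq (loop .X fun b => seq (push .Y b) (pop .P fun _ => skip)) <|
  pop .P fun o => match o with
    | none => diagonalProg
    | some _ => seq (clear .P) (seq (simulateProg false) (simulateProg true))

theorem spec_selectProg {y W D C0 : List Sym} {n N : ℕ}
    (hn : W.length + y.length = n) (hC : C0.length + D.length ≤ n) (hN : N = 2 ^ n) :
    ∃ s, Spec selectProg (base y W [] D [] C0) (guarded
      (if 2 ^ D.length ≤ y.length then
        Core.verdict C0.reverse (loadBits W []) y ≠ []
      else ∀ b : Bool, ∃ v : List Bool, v.length = N ∧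
        Core.verdict C0.reverse (loadBits W (loadBits y.reverse [.bit true, .bit b]))
          (v.map .bit) = []) s)
      (3000 * (N * N * N * N)) := by
  have hnN : n + 1 ≤ N := hN ▸ Nat.lt_two_pow_self
  have hDN : 2 ^ D.length ≤ N := hN ▸ Nat.pow_le_pow_right (by omega) (by omega)
  have h1 : 1 ≤ N := by omega
  have h2 : N ≤ N * N := Nat.le_mul_of_pos_right _ h1
  have h3 : N * N ≤ N * N * N := Nat.le_mul_of_pos_right _ h1
  have h4 : N * N * N ≤ N * N * N * N := Nat.le_mul_of_pos_right _ h1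
  have e1 := spec_push (base y W [] D [] C0) .P mark
  have e2 := (spec_doubleProg (k := 1) (s := base y W [] D [mark] C0) rfl rfl).congr
    (s₂ := base y W [] [] (List.replicate (2 ^ D.length) mark) C0) (t' := 20 * (N * N) + 1)
    (by simp [base]) (by
      simp only [base, one_mul]
      have : (16 * 2 ^ D.length + 4) * D.length ≤ (16 * N + 4) * N := by gcongr; omega
      have : (16 * N + 4) * N = 16 * (N * N) + 4 * N := by ring
      omega)
  have e3 := spec_loop_foldl (i := .X) (f := fun b => seq (push .Y b) (pop .P fun _ => skip))
    (g := fun b s => { s with Y := b :: s.Y, P := s.P.tail })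
    (fun a s => spec_then (spec_push s _ _) (spec_pop (spec_skip _))) (fun _ _ _ => rfl)
    (base y W [] [] (List.replicate (2 ^ D.length) mark) C0)
  have hfold : ∀ (l : List Sym) (s : Store),
      l.foldl (fun s b => { s with Y := b :: s.Y, P := s.P.tail }) s =
        { s with Y := l.reverse ++ s.Y, P := s.P.drop l.length } := by
    intro l
    induction l with
    | nil => intro s; rfl
    | cons a l ih => intro s; rw [List.foldl_cons, ih]; simp
  rw [hfold] at e3
  -- One mark of the `2 ^ D.length` is removed for each bit of `y`; whether any mark remains decides
  -- the comparison.
  replace e3 := e3.congr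
    (s₂ := base [] W y.reverse [] (List.replicate (2 ^ D.length - y.length) mark) C0)
    (t' := 7 * N + 1)
    (by simp [base, Store.get, Store.set]) (by simp [base, Store.get]; omega)
  by_cases hy : 2 ^ D.length ≤ y.length
  · obtain ⟨s, e4⟩ := spec_diagonalProg (W := W) (Y := y.reverse) (C0 := C0) (n := n) (N := N)
      (by simpa using hn) (by omega) hN
    refine ⟨s, ?_⟩
    rw [if_pos hy]
    rw [List.reverse_reverse] at e4
    have e5 : Spec (pop .P fun o => match o with
      | none => diagonalProg
      | some _ => seq (clear .P) (seq (simulateProg false) (simulateProg true)))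
        (base [] W y.reverse [] (List.replicate (2 ^ D.length - y.length) mark) C0) _ _ :=
      spec_pop (by
        rw [Nat.sub_eq_zero_of_le hy]
        exact e4)
    refine (spec_then e1 <| spec_then e2 <| spec_then e3 e5).mono ?_
    omega
  · have hf := spec_simulateProg false (W := W) (Y := y.reverse) (C0 := C0) (n := n) (N := N)
      (by simpa using hn) (by omega) hN
    have ht := spec_simulateProg true (W := W) (Y := y.reverse) (C0 := C0) (n := n) (N := N)
      (by simpa using hn) (by omega) hN
    refine ⟨base [] W y.reverse [] [] C0, ?_⟩
    rw [if_neg hy]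
    -- The universal quantifier over the next bit is the succession of two simulations, both of
    -- which must succeed.
    have e6 := spec_seq (R' := guarded (∀ b : Bool, ∃ v : List Bool, v.length = N ∧
        Core.verdict C0.reverse (loadBits W (loadBits y.reverse [.bit true, .bit b]))
          (v.map .bit) = []) (base [] W y.reverse [] [] C0)) hf
      (F := fun _ => guarded (∃ v : List Bool, v.length = N ∧ Core.verdict C0.reverse (loadBits W
        (loadBits y.reverse [.bit true, .bit true])) (v.map .bit) = [])
        (base [] W y.reverse [] [] C0)) (by rintro _ ⟨rfl, -⟩; exact ht) (by
      ext s'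
      simp only [guarded, Set.mem_ofPred_eq, Set.mem_iUnion, Bool.forall_bool]
      constructor
      · rintro ⟨rfl, hf, ht⟩; exact ⟨_, ⟨rfl, hf⟩, rfl, ht⟩
      · rintro ⟨_, ⟨rfl, hf⟩, rfl, ht⟩; exact ⟨rfl, hf, ht⟩)
    obtain ⟨k, hk⟩ : ∃ k, 2 ^ D.length - y.length = k + 1 :=
      ⟨2 ^ D.length - y.length - 1, by omega⟩
    have e4 := spec_clear .P (base [] W y.reverse [] (List.replicate k mark) C0)
    have e5 : Spec (pop .P fun o => match o with
      | none => diagonalProg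
      | some _ => seq (clear .P) (seq (simulateProg false) (simulateProg true)))
        (base [] W y.reverse [] (List.replicate (2 ^ D.length - y.length) mark) C0) _ _ :=
      spec_pop (by
        rw [hk]
        exact spec_then e4 e6)
    refine (spec_then e1 <| spec_then e2 <| spec_then e3 e5).mono ?_
    simp only [base, Store.get, List.length_replicate]
    omega

/-- Process a token other than `endCode`, or leave the loop over the tokens. -/
def tokenProg (t : Tok) : Prog :=
  if t = .endCode then skip
  else if t = .double then seq (push .D mark) (push .G mark)
  else seq (push .C0 (.tok t)) (push .G mark)

/-- Read a token. -/
def readProg : Prog :=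
  pop .X fun o₁ => pop .X fun o₂ => pop .X fun o₃ => pop .X fun o₄ => match o₄ with
    | none => fail
    | some a => seq (push .W (o₁.getD mark)) <| seq (push .W (o₂.getD mark)) <|
      seq (push .W (o₃.getD mark)) <| seq (push .W a) <|
      tokenProg (decode (isOne o₁) (isOne o₂) (isOne o₃) (isOne o₄))

/-- The store while the tokens are read. -/
def reading (x : List Bool) (W G D C0 : List Sym) : Store :=
  ⟨x.map .bit, W, [], [], [], G, D, [], [], C0, [], [], [], [], [], ⟨[], [], [], [], [], []⟩⟩

theorem isOne_bit (b : Bool) : isOne (some (.bit b)) = b := by cases b <;> rfl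

theorem spec_readProg (b₁ b₂ b₃ b₄ : Bool) (x : List Bool) (W D C0 : List Sym) {s : Store}
    (h : Spec (tokenProg (decode b₁ b₂ b₃ b₄))
      (reading x (.bit b₄ :: .bit b₃ :: .bit b₂ :: .bit b₁ :: W) [] D C0) {s} 7) :
    Spec readProg (reading (b₁ :: b₂ :: b₃ :: b₄ :: x) W [] D C0) {s} 27 := by
  have h' : Spec (tokenProg (decode (isOne (some (.bit b₁))) (isOne (some (.bit b₂)))
      (isOne (some (.bit b₃))) (isOne (some (.bit b₄)))))
      (reading x (.bit b₄ :: .bit b₃ :: .bit b₂ :: .bit b₁ :: W) [] D C0) {s} 7 := by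
    simpa only [isOne_bit] using h
  have e := spec_then (spec_push (reading x W [] D C0) .W (.bit b₁)) <|
    spec_then (spec_push _ .W (.bit b₂)) <| spec_then (spec_push _ .W (.bit b₃)) <|
    spec_then (spec_push _ .W (.bit b₄)) h'
  exact spec_pop <| spec_pop <| spec_pop <| spec_pop e

/-- The stack `G` is the loop condition: each token puts a mark back on it, except for `endCode`. An
input that ends before `endCode` makes all paths fail. -/
theorem spec_readLoop (x : List Bool) (W D C0 : List Sym) :
    Spec (loop .G fun _ => readProg) (reading x W [mark] D C0)
      {s | ∃ r, parse x W D C0 = some r ∧ s = reading r.1 r.2.1 [] r.2.2.1 r.2.2.2}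
      (28 * x.length + 29) := by
  induction x, W, D, C0 using parse.induct with
  | case1 b₁ b₂ b₃ b₄ x W D C t ht =>
    have h1 := spec_readProg b₁ b₂ b₃ b₄ x W D C (by
      rw [show decode b₁ b₂ b₃ b₄ = t from rfl, tokenProg, if_pos ht]
      exact (spec_skip _).mono (by omega))
    have h2 := spec_loop_nil (i := .G) (f := fun _ => readProg) (s := reading x (.bit b₄ :: .bit b₃ ::
      .bit b₂ :: .bit b₁ :: W) [] D C) rfl
    have h3 := spec_loop_cons (s := reading (b₁ :: b₂ :: b₃ :: b₄ :: x) W [mark] D C)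
      (i := .G) (f := fun _ => readProg) rfl h1 h2
    refine h3.congr_set (fun s' => ?_) (by omega)
    rw [parse, if_pos ht]
    simp
  | case2 b₁ b₂ b₃ b₄ x W D C W' t ht ht' ih =>
    have h1 := spec_readProg b₁ b₂ b₃ b₄ x W D C (by
      rw [show decode b₁ b₂ b₃ b₄ = t from rfl, tokenProg, if_neg ht, if_pos ht']
      exact spec_then (spec_push _ _ _) (spec_push _ _ _))
    have h3 := spec_loop_cons (s := reading (b₁ :: b₂ :: b₃ :: b₄ :: x) W [mark] D C)
      (i := .G) (f := fun _ => readProg) rfl h1 ih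
    rw [parse, if_neg ht, if_pos ht']
    exact h3.mono (by simp only [List.length_cons]; omega)
  | case3 b₁ b₂ b₃ b₄ x W D C W' t ht ht' ih =>
    have h1 := spec_readProg b₁ b₂ b₃ b₄ x W D C (by
      rw [show decode b₁ b₂ b₃ b₄ = t from rfl, tokenProg, if_neg ht, if_neg ht']
      exact spec_then (spec_push _ _ _) (spec_push _ _ _))
    have h3 := spec_loop_cons (s := reading (b₁ :: b₂ :: b₃ :: b₄ :: x) W [mark] D C)
      (i := .G) (f := fun _ => readProg) rfl h1 ih
    rw [parse, if_neg ht, if_neg ht']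
    exact h3.mono (by simp only [List.length_cons]; omega)
  | case4 x W D C hx =>
    have hlen : x.length < 4 := by
      by_contra h
      match x, hx, h with
      | b₁ :: b₂ :: b₃ :: b₄ :: x, hx, _ => exact hx b₁ b₂ b₃ b₄ x rfl
      | [], _, h => simp at h
      | [_], _, h => simp at h
      | [_, _], _, h => simp at h
      | [_, _, _], _, h => simp at h
    have h1 : Spec readProg (reading x W [] D C) ∅ 5 := by
      refine spec_pop (spec_pop (spec_pop (spec_pop ?_)))
      match x, hlen with
      | [], _ => exact spec_fail _
      | [_], _ => exact spec_fail _
      | [_, _], _ => exact spec_fail _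
      | [_, _, _], _ => exact spec_fail _
    have h3 := spec_loop_cons' (s := reading x W [mark] D C) (R' := ∅)
      (i := .G) (f := fun _ => readProg) rfl h1 (F := fun _ => ∅) (t' := 0) (by simp) (by simp)
    refine h3.congr_set (fun s' => ?_) (by omega)
    rw [parse]
    · simp
    · exact hx

/-- The program of the universal machine. -/
def universal : Prog :=
  seq (push .G mark) <| seq (loop .G fun _ => readProg) selectProg

theorem spec_universal (x : List Bool) :
    ∃ R, Spec universal (initStore x) R (4000 * 2 ^ (4 * x.length)) ∧ (R.Nonempty ↔ Accepted x) := by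
  have e1 : Spec (push .G mark) (initStore x) {reading x [] [mark] [] []} 3 := spec_push _ _ _
  have e2 := spec_readLoop x [] [] []
  set N := 2 ^ x.length with hN
  have hpow : 2 ^ (4 * x.length) = N * N * N * N := by rw [hN]; ring
  have hnN : x.length + 1 ≤ N := hN ▸ Nat.lt_two_pow_self
  have h1 : 1 ≤ N := by omega
  have h2 : N ≤ N * N := Nat.le_mul_of_pos_right _ h1
  have h3 : N * N ≤ N * N * N := Nat.le_mul_of_pos_right _ h1
  have h4 : N * N * N ≤ N * N * N * N := Nat.le_mul_of_pos_right _ h1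
  rw [hpow]
  rcases hr : parse x [] [] [] with _ | r
  · refine ⟨∅, (spec_then e1 (spec_seq (R' := ∅) (F := fun _ => ∅) (t' := 0) e2 ?_ ?_)).mono ?_, ?_⟩
    · simp [hr]
    · simp
    · omega
    · simp [Accepted, hr]
  · have hlen := length_of_parse hr
    simp only [List.length_nil, Nat.zero_add] at hlen
    obtain ⟨s, e3⟩ := spec_selectProg (y := r.1.map .bit) (W := r.2.1) (D := r.2.2.1)
      (C0 := r.2.2.2) (n := x.length) (N := N) (by simpa using hlen.1) (by omega) hN
    replace e2 := e2.congr_set (R' := {base (r.1.map .bit) r.2.1 [] r.2.2.1 [] r.2.2.2})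
      (fun s' => by simp only [hr, Option.some.injEq, exists_eq_left']; rfl) le_rfl
    refine ⟨_, (spec_then e1 (spec_then e2 e3)).mono (by omega), ?_⟩
    simp only [Accepted, hr, Option.some.injEq, exists_eq_left', guarded, List.map_reverse,
      List.length_map, ← hN]
    exact ⟨fun ⟨_, _, h⟩ => h, fun h => ⟨s, rfl, h⟩⟩

end Prog

/-! ### Replaying operations on a single tape -/

open Turing

/-- A replayed tape: the contents to the left of the head, and from the head on to the right. -/
abbrev Pos := ListBlank Bool × ListBlank Bool

/-- An operation on a replayed tape, which replaces the words `lp` and `rp` next to the head by the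
words `lq` and `rq`. -/
structure Block where
  lp : List Bool
  rp : List Bool
  lq : List Bool
  rq : List Bool

namespace Block

def Applies (b : Block) (p q : Pos) : Prop :=
  ∃ l r, p = (ListBlank.append b.lp l, ListBlank.append b.rp r) ∧
    q = (ListBlank.append b.lq l, ListBlank.append b.rq r)

/-- The tokens that perform the operation. -/
def toks (b : Block) : List Sym :=
  b.lp.map (fun x => .tok (.pop true x)) ++ b.rp.map (fun x => .tok (.pop false x)) ++
    -- The last symbol is pushed first, so that the word reads outward from the head.
    b.lq.reverse.map (fun x => .tok (.push true x)) ++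
    b.rq.reverse.map (fun x => .tok (.push false x))

/-- A sequence of operations leads from one tape to another one. -/
def Replay : List Block → Pos → Pos → Prop
  | [], p, q => p = q
  | b :: h, p, q => ∃ m, b.Applies p m ∧ Replay h m q

theorem replay_append {h h' : List Block} {p q : Pos} :
    Replay (h ++ h') p q ↔ ∃ m, Replay h p m ∧ Replay h' m q := by
  induction h generalizing p with
  | nil => simp [Replay]
  | cons b h ih =>
    simp only [List.cons_append, Replay, ih]
    constructor
    · rintro ⟨m, h1, m', h2, h3⟩; exact ⟨m', ⟨m, h1, h2⟩, h3⟩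
    · rintro ⟨m', ⟨m, h1, h2⟩, h3⟩; exact ⟨m, h1, m', h2, h3⟩

end Block

theorem append_left_cancel {Γ : Type*} [Inhabited Γ] (l : List Γ) {a b : ListBlank Γ}
    (h : ListBlank.append l a = ListBlank.append l b) : a = b := by
  induction l with
  | nil => exact h
  | cons x l ih =>
    refine ih ?_
    have := congrArg ListBlank.tail h
    simpa [ListBlank.append] using this

/-- The contents of a stack of bits, extended by blanks. -/
def content (l : List Sym) : ListBlank Bool := ListBlank.mk (l.map fun a => isOne (some a))

theorem content_nil : content [] = ListBlank.mk [] := rfl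

theorem head_content (l : List Sym) : (content l).head = isOne l.head? := by
  cases l <;> rfl

theorem tail_content (l : List Sym) : (content l).tail = content l.tail := by
  cases l <;> rfl

theorem content_cons_bit (b : Bool) (l : List Sym) :
    content (.bit b :: l) = ListBlank.cons b (content l) := by
  cases b <;> rfl

theorem content_map_bit_append (x : List Bool) (l : List Sym) :
    content (x.map .bit ++ l) = ListBlank.append x (content l) := by
  induction x with
  | nil => rfl
  | cons b x ih => rw [List.map_cons, List.cons_append, content_cons_bit, ih]; rfl

namespace Core

def pos (c : Core) : Pos := (content c.L, content c.R)

theorem ite_cons_eq_nil {p : Prop} [Decidable p] {a : Sym} {l : List Sym} :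
    (if p then l else a :: l) = [] ↔ l = [] ∧ p := by
  by_cases hp : p <;> simp [hp]

/-- The pops always remove `w.length` symbols, whether they match or not; that `F` is still empty
certifies that every one of them matched. -/
theorem foldl_popLeft (w : List Bool) (c : Core) (hA : c.A ≠ []) :
    ∃ f, (w.map fun x => Sym.tok (.pop true x)).foldl step c =
      { c with L := c.L.drop w.length, F := f } ∧
      (f = [] ↔ c.F = [] ∧ content c.L = ListBlank.append w (content (c.L.drop w.length))) := by
  induction w generalizing c with
  | nil => exact ⟨c.F, rfl, by simp [ListBlank.append]⟩
  | cons b w ih =>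
    obtain ⟨f, hf, hf'⟩ := ih (c.popBit true b) hA
    refine ⟨f, ?_, ?_⟩
    · rw [List.map_cons, List.foldl_cons]
      have : c.step (.tok (.pop true b)) = c.popBit true b := if_neg hA
      rw [this, hf]
      simp [popBit]
    · rw [hf']
      simp only [popBit, ite_cons_eq_nil, List.length_cons, List.drop_tail, and_assoc,
        ← head_content, ← tail_content]
      refine and_congr_right fun _ => ?_
      rw [ListBlank.append]
      constructor
      · rintro ⟨h1, h2⟩
        rw [← h2, ← h1, ListBlank.cons_head_tail]
      · intro h
        rw [h]
        simp

theorem foldl_popRight (w : List Bool) (c : Core) (hA : c.A ≠ []) :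
    ∃ f, (w.map fun x => Sym.tok (.pop false x)).foldl step c =
      { c with R := c.R.drop w.length, F := f } ∧
      (f = [] ↔ c.F = [] ∧ content c.R = ListBlank.append w (content (c.R.drop w.length))) := by
  induction w generalizing c with
  | nil => exact ⟨c.F, rfl, by simp [ListBlank.append]⟩
  | cons b w ih =>
    obtain ⟨f, hf, hf'⟩ := ih (c.popBit false b) hA
    refine ⟨f, ?_, ?_⟩
    · rw [List.map_cons, List.foldl_cons]
      have : c.step (.tok (.pop false b)) = c.popBit false b := if_neg hA
      rw [this, hf]
      simp [popBit]
    · rw [hf']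
      simp only [popBit, ite_cons_eq_nil, List.length_cons, List.drop_tail, and_assoc,
        ← head_content, ← tail_content]
      refine and_congr_right fun _ => ?_
      rw [ListBlank.append]
      constructor
      · rintro ⟨h1, h2⟩
        rw [← h2, ← h1, ListBlank.cons_head_tail]
      · intro h
        rw [h]
        simp

theorem foldl_pushLeft (w : List Bool) (c : Core) (hA : c.A ≠ []) :
    (w.reverse.map fun x => Sym.tok (.push true x)).foldl step c =
      { c with L := w.map .bit ++ c.L } := by
  induction w with
  | nil => rfl
  | cons b w ih =>
    rw [List.reverse_cons, List.map_append, List.foldl_append, ih]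
    exact if_neg hA

theorem foldl_pushRight (w : List Bool) (c : Core) (hA : c.A ≠ []) :
    (w.reverse.map fun x => Sym.tok (.push false x)).foldl step c =
      { c with R := w.map .bit ++ c.R } := by
  induction w with
  | nil => rfl
  | cons b w ih =>
    rw [List.reverse_cons, List.map_append, List.foldl_append, ih]
    exact if_neg hA

/-- From `c` to `d` the operations of the history `h` are replayed. -/
structure Replays (h : List Block) (c d : Core) : Prop where
  sound : d.F = [] → c.F = [] ∧ Block.Replay h c.pos d.pos
  complete : ∀ q, c.F = [] → Block.Replay h c.pos q → d.F = [] ∧ d.pos = q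

theorem Replays.trans {h h' : List Block} {c d e : Core} (hcd : Replays h c d)
    (hde : Replays h' d e) : Replays (h ++ h') c e where
  sound he := by
    obtain ⟨h1, h2⟩ := hde.sound he
    obtain ⟨h3, h4⟩ := hcd.sound h1
    exact ⟨h3, Block.replay_append.2 ⟨_, h4, h2⟩⟩
  complete q hc hq := by
    obtain ⟨m, h1, h2⟩ := Block.replay_append.1 hq
    obtain ⟨h3, rfl⟩ := hcd.complete m hc h1
    exact hde.complete q h3 h2

theorem replays_nil {c d : Core} (hF : d.F = c.F) (hpos : d.pos = c.pos) : Replays [] c d where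
  sound h := ⟨hF ▸ h, hpos.symm⟩
  complete _ hc hq := ⟨hF.trans hc, hpos.trans hq⟩

/-- Since a word can be split off from a half tape in only one way, the operation is a partial
function, which the stacks compute with `F` recording undefinedness. -/
theorem foldl_toks_active (b : Block) (c : Core) (hA : c.A ≠ []) :
    Replays [b] c (b.toks.foldl step c) ∧ (b.toks.foldl step c).A = c.A ∧
      (b.toks.foldl step c).U = c.U := by
  obtain ⟨f, hf, hf'⟩ := foldl_popLeft b.lp c hA
  obtain ⟨g, hg, hg'⟩ := foldl_popRight b.rp { c with L := c.L.drop b.lp.length, F := f } hA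
  have hd : b.toks.foldl step c = { c with
      L := b.lq.map .bit ++ c.L.drop b.lp.length
      R := b.rq.map .bit ++ c.R.drop b.rp.length
      F := g } := by
    rw [Block.toks, List.foldl_append, List.foldl_append, List.foldl_append, hf, hg]
    rw [foldl_pushLeft, foldl_pushRight]
    · exact hA
    · exact hA
  rw [hd]
  refine ⟨⟨fun h => ?_, fun _ hF hq => ?_⟩, rfl, rfl⟩
  · obtain ⟨h1, h2⟩ := hg'.1 h
    obtain ⟨h3, h4⟩ := hf'.1 h1
    refine ⟨h3, _, ⟨content (c.L.drop b.lp.length), content (c.R.drop b.rp.length), ?_, rfl⟩, ?_⟩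
    · exact Prod.ext h4 h2
    · simp only [pos, content_map_bit_append]
      exact (rfl : _ = _)
  · obtain ⟨m, ⟨l, r, hp, rfl⟩, rfl⟩ := hq
    have key : ∀ (w : List Bool) (s : List Sym) (l : ListBlank Bool),
        content s = ListBlank.append w l → content (s.drop w.length) = l := by
      intro w
      induction w with
      | nil => intro s l h; exact h
      | cons b w ih =>
        intro s l h
        rw [List.length_cons, ← List.drop_tail]
        apply ih
        rw [← tail_content, h, ListBlank.append, ListBlank.tail_cons]
    have hl : content c.L = _ := congrArg Prod.fst hp
    have hr : content c.R = _ := congrArg Prod.snd hp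
    have hl' := key _ _ _ hl
    have hr' := key _ _ _ hr
    refine ⟨hg'.2 ⟨hf'.2 ⟨hF, ?_⟩, ?_⟩, ?_⟩
    · rw [hl, hl']
    · rw [hr, hr']
    · simp only [pos, content_map_bit_append, hl', hr']

theorem foldl_toks_inactive (b : Block) (c : Core) (hA : c.A = []) : b.toks.foldl step c = c := by
  have : ∀ l : List Sym, (∀ a ∈ l, c.step a = c) → l.foldl step c = c := by
    intro l
    induction l with
    | nil => intro _; rfl
    | cons a l ih =>
      intro h
      rw [List.foldl_cons, h a (by simp)]
      exact ih fun a' ha' => h a' (by simp [ha'])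
  apply this
  intro a ha
  simp only [Block.toks, List.mem_append, List.mem_map] at ha
  rcases ha with ((⟨x, -, rfl⟩ | ⟨x, -, rfl⟩) | ⟨x, -, rfl⟩) | ⟨x, -, rfl⟩ <;> exact if_pos hA

end Core

/-! ### Witnesses as selections of rules -/

/-- The entries of a list that are picked by a list of bits. -/
def pick {α : Type*} : List α → List Bool → List α
  | [], _ => []
  | _ :: _, [] => []
  | a :: l, b :: u => if b then a :: pick l u else pick l u

/-- The entries that are picked in a number of passes over a list. -/
def history {α : Type*} (l : List α) : ℕ → List Bool → List α
  | 0, _ => []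
  | n + 1, u => pick l u ++ history l n (u.drop l.length)

theorem pick_map {α β : Type*} (f : α → β) (l : List α) (u : List Bool) :
    pick (l.map f) u = (pick l u).map f := by
  induction l generalizing u with
  | nil => rfl
  | cons a l ih =>
    rcases u with _ | ⟨_ | _, u⟩
    · rfl
    · simpa [pick] using ih u
    · simpa [pick] using ih u

theorem history_map {α β : Type*} (f : α → β) (l : List α) (n : ℕ) (u : List Bool) :
    history (l.map f) n u = (history l n u).map f := by
  induction n generalizing u with
  | zero => rfl
  | succ n ih => simp [history, pick_map, ih]

theorem pick_nil {α : Type*} (l : List α) : pick l [] = [] := by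
  cases l <;> rfl

theorem mem_of_mem_pick {α : Type*} {l : List α} {u : List Bool} {a : α} (h : a ∈ pick l u) :
    a ∈ l := by
  induction l generalizing u with
  | nil => exact h
  | cons b l ih =>
    rcases u with _ | ⟨_ | _, u⟩
    · cases h
    · exact List.mem_cons_of_mem _ (ih (by simpa [pick] using h))
    · simp only [pick, if_true, List.mem_cons] at h
      exact List.mem_cons.2 (h.imp_right ih)

theorem mem_of_mem_history {α : Type*} {l : List α} {n : ℕ} {u : List Bool} {a : α}
    (h : a ∈ history l n u) : a ∈ l := by
  induction n generalizing u with
  | zero => cases h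
  | succ n ih =>
    rcases List.mem_append.1 h with h | h
    · exact mem_of_mem_pick h
    · exact ih h

theorem pick_replicate_false {α : Type*} (l : List α) (n : ℕ) :
    pick l (List.replicate n false) = [] := by
  induction l generalizing n with
  | nil => rfl
  | cons a l ih =>
    cases n with
    | zero => rfl
    | succ n => simpa [List.replicate_succ, pick] using ih n

theorem history_replicate_false {α : Type*} (l : List α) (n m : ℕ) :
    history l n (List.replicate m false) = [] := by
  induction n generalizing m with
  | zero => rfl
  | succ n ih => simp [history, pick_replicate_false, ih]

theorem pick_map_append {α : Type*} (l : List α) (p : α → Bool) (u : List Bool) :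
    pick l (l.map p ++ u) = l.filter p := by
  induction l with
  | nil => rfl
  | cons a l ih =>
    simp only [List.map_cons, List.cons_append, pick, List.filter_cons, ih]

/-- Every list of entries is picked by all sufficiently long lists of bits. -/
theorem exists_history {α : Type*} {l : List α} (hl : l.Nodup) (h : List α) (hh : ∀ a ∈ h, a ∈ l)
    {n m : ℕ} (hn : h.length ≤ n) (hm : h.length * l.length ≤ m) :
    ∃ u : List Bool, u.length = m ∧ history l n u = h := by
  classical
  induction h generalizing n m with
  | nil => exact ⟨List.replicate m false, by simp, history_replicate_false _ _ _⟩
  | cons a h ih =>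
    obtain ⟨n, rfl⟩ : ∃ k, n = k + 1 := ⟨n - 1, by simp only [List.length_cons] at hn; omega⟩
    rw [List.length_cons, Nat.succ_mul] at hm
    obtain ⟨u, hu, hu'⟩ := ih (fun b hb => hh b (by simp [hb])) (n := n) (m := m - l.length)
      (by simpa using hn) (by omega)
    -- Each pass is used for a single entry: its bits are the indicator of `a`, which occurs in `l`
    -- exactly once.
    refine ⟨l.map (fun b => decide (b = a)) ++ u, by simp; omega, ?_⟩
    rw [history, pick_map_append, List.drop_left' (by simp), hu']
    have : l.filter (fun b => decide (b = a)) = [a] := by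
      have h1 : (fun b => decide (b = a)) = (· == a) := by
        funext b; simp [beq_eq_decide]
      rw [h1, List.filter_beq, List.count_eq_one_of_mem hl (hh a (by simp))]
      rfl
    rw [this]
    rfl

/-! ### The verdict on the code of a list of sections -/

/-- The code of a section. -/
def sectionCode (bs : List Block) : List Sym :=
  bs.flatMap fun b => .tok .rule :: b.toks

namespace Core

/-- Each `rule` token consumes one witness bit and activates the block behind it if the bit is set.
An exhausted witness counts as `false`, in accordance with `pick`. -/
theorem pass_sectionCode (bs : List Block) (u : List Bool) (c : Core) (hA : c.A.length ≤ 1)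
    (hU : c.U = u.map .bit) :
    Replays (pick bs u) c (c.pass (sectionCode bs)) ∧
      (c.pass (sectionCode bs)).A.length ≤ 1 ∧
      (c.pass (sectionCode bs)).U = (u.drop bs.length).map .bit := by
  induction bs generalizing u c with
  | nil => exact ⟨replays_nil rfl rfl, hA, by simpa [pass, sectionCode] using hU⟩
  | cons b bs ih =>
    have hpass : c.pass (sectionCode (b :: bs)) =
        (b.toks.foldl step (c.step (.tok .rule))).pass (sectionCode bs) := by
      simp [pass, sectionCode, List.foldl_append]
    have htail : c.A.tail = [] := List.eq_nil_of_length_eq_zero (by simp; omega)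
    rw [hpass]
    rcases u with _ | ⟨x, u⟩
    · have h1 : c.step (.tok .rule) = { c with A := [] } := by simp [step, hU, htail]
      rw [h1, foldl_toks_inactive b _ rfl]
      obtain ⟨h2, h3, h4⟩ := ih [] { c with A := [] } (by simp) hU
      refine ⟨?_, h3, by simpa using h4⟩
      rw [pick_nil] at h2 ⊢
      exact ⟨h2.sound, h2.complete⟩
    · cases x with
      | false =>
        have h1 : c.step (.tok .rule) =
            { c with A := [], U := u.map .bit, U2 := .bit false :: c.U2 } := by
          simp [step, hU, htail]
        rw [h1, foldl_toks_inactive b _ rfl]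
        obtain ⟨h2, h3, h4⟩ := ih u { c with
          A := [], U := u.map .bit, U2 := .bit false :: c.U2 } (by simp) rfl
        exact ⟨⟨h2.sound, h2.complete⟩, h3, by simpa using h4⟩
      | true =>
        have h1 : c.step (.tok .rule) =
            { c with A := [.bit true], U := u.map .bit, U2 := .bit true :: c.U2 } := by
          simp [step, hU, htail]
        rw [h1]
        obtain ⟨h5, h6, h7⟩ := foldl_toks_active b { c with
          A := [.bit true], U := u.map .bit, U2 := .bit true :: c.U2 } (by simp)
        obtain ⟨h2, h3, h4⟩ := ih u (b.toks.foldl step { c with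
          A := [.bit true], U := u.map .bit, U2 := .bit true :: c.U2 }) (by rw [h6]; simp) h7
        have h8 := h5.trans h2
        exact ⟨⟨h8.sound, h8.complete⟩, h3, by simpa using h4⟩

theorem passes_sectionCode (bs : List Block) (n : ℕ) (u : List Bool) (c : Core)
    (hA : c.A.length ≤ 1) (hU : c.U = u.map .bit) :
    Replays (history bs n u) c ((pass (sectionCode bs))^[n] c) := by
  induction n generalizing u c with
  | zero => exact replays_nil rfl rfl
  | succ n ih =>
    obtain ⟨h1, h2, h3⟩ := pass_sectionCode bs u c hA hU
    rw [Function.iterate_succ_apply]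
    exact h1.trans (ih _ _ h2 h3)

end Core

/-- The history that is picked by `u` leads from the given tape to one that carries the mark of
acceptance. -/
def SectionAccepts (bs : List Block) (r : ListBlank Bool) (u : List Bool) : Prop :=
  ∃ q : Pos, Block.Replay (history bs u.length u) (ListBlank.mk [], r) q ∧ q.1.head = true

theorem runSection_sectionCode (bs : List Block) (u : List Bool) (r f : List Sym) :
    ∃ f', Core.runSection (sectionCode bs) ⟨[], u.map .bit, [], [], r, f⟩ =
      ⟨[], u.map .bit, [], [], [], f'⟩ ∧ (f' = [] ↔ f = [] ∧ SectionAccepts bs (content r) u) := by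
  refine ⟨_, rfl, ?_⟩
  have h := Core.passes_sectionCode bs u.length u ⟨[], u.map .bit, [], [], r, f⟩ (by simp) rfl
  simp only [List.length_map]
  rw [Core.ite_cons_eq_nil, ← head_content]
  constructor
  · rintro ⟨h1, h2⟩
    obtain ⟨h3, h4⟩ := h.sound h1
    exact ⟨h3, _, h4, h2⟩
  · rintro ⟨h1, q, h2, h3⟩
    obtain ⟨h4, h5⟩ := h.complete q h1 h2
    refine ⟨h4, ?_⟩
    rw [← h3, ← h5]
    rfl

theorem foldl_codeStep_of_notMem (l s : List Sym) (c : Core) (hl : .tok .endSection ∉ l) :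
    l.foldl Core.codeStep (s, c) = (l.reverse ++ s, c) := by
  induction l generalizing s with
  | nil => rfl
  | cons a l ih =>
    simp only [List.mem_cons, not_or] at hl
    rw [List.foldl_cons, Core.codeStep, if_neg (Ne.symm hl.1), ih _ hl.2]
    simp

theorem notMem_sectionCode (bs : List Block) : .tok .endSection ∉ sectionCode bs := by
  simp [sectionCode, Block.toks]

/-- The code of a list of sections. -/
def fullCode (S : List (List Block)) : List Sym :=
  S.flatMap fun bs => sectionCode bs ++ [.tok .endSection]

/-- The end of a section empties the stacks of the tape but keeps the witness. Hence only the first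
section sees the input `r`, and all others start on a blank tape. -/
theorem foldl_codeStep_fullCode (bs : List Block) (S : List (List Block)) (u : List Bool)
    (r f : List Sym) : ∃ f', (fullCode (bs :: S)).foldl Core.codeStep
      ([], ⟨[], u.map .bit, [], [], r, f⟩) = ([], ⟨[], u.map .bit, [], [], [], f'⟩) ∧
      (f' = [] ↔ f = [] ∧ SectionAccepts bs (content r) u ∧
        ∀ bs' ∈ S, SectionAccepts bs' (content []) u) := by
  obtain ⟨g, hg, hg'⟩ := runSection_sectionCode bs u r f
  have hsec : (sectionCode bs ++ [Sym.tok .endSection]).foldl Core.codeStep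
      ([], ⟨[], u.map .bit, [], [], r, f⟩) = ([], ⟨[], u.map .bit, [], [], [], g⟩) := by
    rw [List.foldl_append, foldl_codeStep_of_notMem _ _ _ (notMem_sectionCode bs)]
    simp only [List.foldl_cons, List.foldl_nil, Core.codeStep, if_true, List.append_nil,
      List.reverse_reverse, hg]
  induction S generalizing bs r f g with
  | nil =>
    refine ⟨g, ?_, by simpa using hg'⟩
    simpa [fullCode] using hsec
  | cons bs' S ih =>
    obtain ⟨g', hs, hs'⟩ := runSection_sectionCode bs' u [] g
    obtain ⟨f', h1, h2⟩ := ih bs' [] g g' hs hs' (by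
      rw [List.foldl_append, foldl_codeStep_of_notMem _ _ _ (notMem_sectionCode bs')]
      simp only [List.foldl_cons, List.foldl_nil, Core.codeStep, if_true, List.append_nil,
        List.reverse_reverse, hs])
    refine ⟨f', ?_, ?_⟩
    · rw [fullCode, List.flatMap_cons, List.foldl_append, hsec]
      exact h1
    · rw [h2, hg']
      simp [and_assoc]

/-- The verdict is positive if and only if all sections accept. -/
theorem verdict_fullCode (bs : List Block) (S : List (List Block)) (n : ℕ) (r : List Sym)
    (u : List Bool) :
    Core.verdict (fullCode (bs :: S) ++ List.replicate n mark) r (u.map .bit) = [] ↔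
      SectionAccepts bs (content r) u ∧ ∀ bs' ∈ S, SectionAccepts bs' (content []) u := by
  obtain ⟨f, hf, hf'⟩ := foldl_codeStep_fullCode bs S u r []
  rw [Core.verdict, List.foldl_append, hf, foldl_codeStep_of_notMem, hf']
  · simp
  · simp [List.mem_replicate]

/-! ### Prefix codes for symbols and states -/

instance : Finite Dir :=
  Finite.of_injective (fun d : Dir => d = .left) fun a b h => by
    cases a <;> cases b <;> simp_all

theorem replicate_prefix_inj {n m : ℕ}
    (h : List.replicate n true ++ [false] <+: List.replicate m true ++ [false]) : n = m := by
  induction n generalizing m with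
  | zero =>
    cases m with
    | zero => rfl
    | succ m => simp [List.replicate_succ] at h
  | succ n ih =>
    cases m with
    | zero => simp [List.replicate_succ] at h
    | succ m =>
      simp only [List.replicate_succ, List.cons_append, List.cons_prefix_cons, true_and] at h
      rw [ih h]

/-- A finite type has a prefix code with given code words for three elements. -/
theorem exists_code {α : Type*} [Finite α] (d : α) (b : Bool → α) (hb : Function.Injective b)
    (hd : ∀ x, b x ≠ d) : ∃ e : α → List Bool, (∀ a a', e a <+: e a' → a = a') ∧
      e d = [false, false] ∧ ∀ x, e (b x) = [true, x] := by
  classical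
  obtain ⟨n, ⟨i⟩⟩ := Finite.exists_equiv_fin α
  have hb' : b true ≠ b false := fun h => Bool.noConfusion (hb h)
  -- All further elements get `false, true` followed by a number in unary with an end mark, which
  -- keeps them apart from the three prescribed words.
  refine ⟨fun a => if a = d then [false, false] else if a = b false then [true, false] else
    if a = b true then [true, true] else
      false :: true :: (List.replicate (i a) true ++ [false]), ?_, if_pos rfl, ?_⟩
  · intro a a' h
    simp only at h
    split_ifs at h <;>
      simp only [List.cons_prefix_cons, Bool.true_eq_false, Bool.false_eq_true, false_and, true_and,
        and_false, List.prefix_nil, List.append_eq_nil_iff] at h <;>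
      first
      | (subst_vars; rfl)
      | exact i.injective (Fin.ext (replicate_prefix_inj h))
  · rintro (_ | _)
    · simp [hd]
    · simp [hd, hb']

theorem prefix_or_prefix_of_append_eq {Γ : Type*} [Inhabited Γ] {l l' : List Γ}
    {a b : ListBlank Γ} (h : ListBlank.append l a = ListBlank.append l' b) :
    l <+: l' ∨ l' <+: l := by
  induction l generalizing l' with
  | nil => exact Or.inl (List.nil_prefix)
  | cons x l ih =>
    cases l' with
    | nil => exact Or.inr (List.nil_prefix)
    | cons y l' =>
      have h1 := congrArg ListBlank.head h
      have h2 := congrArg ListBlank.tail h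
      simp only [ListBlank.append, ListBlank.head_cons, ListBlank.tail_cons] at h1 h2
      simpa [h1] using ih h2

/-- Code words for the symbols and states of a machine. -/
structure Coding (M : NTM) where
  sym : M.Γ → List Bool
  sym_free : ∀ a b, sym a <+: sym b → a = b
  -- Blanks are coded by blanks, so that an infinite blank tape corresponds to an empty stack. The
  -- start state has the same code word for the same reason: its section starts on empty stacks.
  sym_blank : sym default = [false, false]
  sym_bit : ∀ x, sym (M.bit x) = [true, x]
  state : M.Q → List Bool
  state_free : ∀ a b, state a <+: state b → a = b
  state_start : state M.start = [false, false]

theorem nonempty_coding (M : NTM) : Nonempty (Coding M) := by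
  obtain ⟨e, h1, h2, h3⟩ := exists_code (default : M.Γ) M.bit M.bit_injective M.bit_ne_blank
  -- The summand `Bool` only supplies the two further elements that `exists_code` asks for.
  obtain ⟨f, h4, h5, -⟩ := exists_code (Sum.inl M.start : M.Q ⊕ Bool) Sum.inr Sum.inr_injective
    (by simp)
  exact ⟨⟨e, h1, h2, h3, fun q => f (.inl q), fun a b h => Sum.inl_injective (h4 _ _ h), h5⟩⟩

/-! ### Histories of rules and accepting computations -/

/-- A step of a machine, with the state, the symbols under the heads, and those to the left of the
heads, or a final configuration. -/
abbrev Rule (M : NTM) : Type :=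
  M.Q × (M.K → M.Γ) × (M.K → M.Γ) × Option (M.Q × (M.K → M.Γ × Option Dir))

def Rule.Valid {M : NTM} (r : Rule M) : Prop :=
  match r.2.2.2 with
  | some a => a ∈ M.δ r.1 r.2.1
  | none => r.1 ∈ M.accept ∧ M.δ r.1 r.2.1 = ∅

namespace Coding

variable {M : NTM} (e : Coding M)

/-- The operation on a tape with the symbols `x` to the left of the head and `y` under it. -/
def actBlock (x y w : M.Γ) : Option Dir → Block
  | none => ⟨e.sym x, e.sym y, e.sym x, e.sym w⟩
  | some .left => ⟨e.sym x, e.sym y, [], e.sym x ++ e.sym w⟩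
  | some .right => ⟨e.sym x, e.sym y, e.sym w ++ e.sym x, []⟩

/-- The operation of a rule on the tape `k`. -/
def tapeBlock (k : M.K) (r : Rule M) : Block :=
  match r.2.2.2 with
  | some a => e.actBlock (r.2.2.1 k) (r.2.1 k) (a.2 k).1 (a.2 k).2
  | none => ⟨[], e.sym (r.2.1 k), [true], []⟩

/-- The operation of a rule on the tape that holds the state. -/
def stateBlock (r : Rule M) : Block :=
  match r.2.2.2 with
  | some a => ⟨[], e.state r.1, [], e.state a.1⟩
  | none => ⟨[], e.state r.1, [true], []⟩

theorem exists_sym_default : ∃ n, e.sym default = List.replicate n default :=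
  ⟨2, e.sym_blank⟩

/-- The code of a half of a tape. -/
def half (l : ListBlank M.Γ) : ListBlank Bool := l.flatMap e.sym e.exists_sym_default

theorem half_cons (a : M.Γ) (l : ListBlank M.Γ) :
    e.half (l.cons a) = ListBlank.append (e.sym a) (e.half l) :=
  ListBlank.cons_flatMap _ _ _ _

theorem half_eq (l : ListBlank M.Γ) :
    e.half l = ListBlank.append (e.sym l.head) (e.half l.tail) := by
  rw [← half_cons, ListBlank.cons_head_tail]

/-- Prefix-freeness makes the first symbol of a half tape readable from its code. -/
theorem half_eq_append_iff {l : ListBlank M.Γ} {a : M.Γ} {b : ListBlank Bool} :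
    e.half l = ListBlank.append (e.sym a) b ↔ l.head = a ∧ e.half l.tail = b := by
  constructor
  · intro h
    rw [half_eq] at h
    have ha : l.head = a := by
      rcases prefix_or_prefix_of_append_eq h with h | h
      · exact e.sym_free _ _ h
      · exact (e.sym_free _ _ h).symm
    rw [ha] at h
    exact ⟨ha, append_left_cancel _ h⟩
  · rintro ⟨rfl, rfl⟩
    exact e.half_eq l

/-- The code of a tape. -/
def tapePos (T : Tape M.Γ) : Pos := (e.half T.left, e.half T.right₀)

/-- The code of a state. -/
def statePos (q : M.Q) : Pos := (ListBlank.mk [], ListBlank.append (e.state q) (ListBlank.mk []))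

/-- A move to the left carries the code word of the symbol beside the head across the head. As the
code words differ in length, this symbol must be part of the rule. -/
theorem actBlock_applies {x y w : M.Γ} {d : Option Dir} {T : Tape M.Γ} {p : Pos} :
    (e.actBlock x y w d).Applies (e.tapePos T) p ↔
      T.left.head = x ∧ T.head = y ∧ p = e.tapePos (NTM.act (w, d) T) := by
  obtain ⟨L, R, rfl⟩ := Tape.exists_mk' T
  have hact : (e.actBlock x y w d).lp = e.sym x ∧ (e.actBlock x y w d).rp = e.sym y ∧
      (L.head = x → e.tapePos (NTM.act (w, d) (Tape.mk' L R)) =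
        (ListBlank.append (e.actBlock x y w d).lq (e.half L.tail),
          ListBlank.append (e.actBlock x y w d).rq (e.half R.tail))) := by
    rcases d with _ | _ | _ <;> refine ⟨rfl, rfl, ?_⟩ <;> rintro rfl <;>
      simp only [NTM.act, tapePos, Tape.write_mk', Tape.move_left_mk', Tape.move_right_mk',
        Tape.mk'_left, Tape.mk'_right₀, actBlock, half_cons, ListBlank.tail_cons,
        ListBlank.head_cons, ListBlank.append_assoc, ListBlank.append]
    · rw [← half_eq]
    · rw [← half_eq]
  obtain ⟨h1, h2, h3⟩ := hact
  unfold Block.Applies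
  rw [h1, h2]
  simp only [tapePos, Tape.mk'_left, Tape.mk'_right₀, Prod.mk.injEq, half_eq_append_iff,
    Tape.mk'_head]
  constructor
  · rintro ⟨l, r, ⟨⟨hx, rfl⟩, hy, rfl⟩, rfl⟩
    exact ⟨hx, hy, (h3 hx).symm⟩
  · rintro ⟨hx, hy, rfl⟩
    exact ⟨_, _, ⟨⟨hx, rfl⟩, hy, rfl⟩, h3 hx⟩

theorem final_applies {y : M.Γ} {T : Tape M.Γ} {p : Pos} :
    Block.Applies ⟨[], e.sym y, [true], []⟩ (e.tapePos T) p ↔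
      T.head = y ∧ p = (ListBlank.cons true (e.half T.left), e.half T.right) := by
  obtain ⟨L, R, rfl⟩ := Tape.exists_mk' T
  unfold Block.Applies
  simp only [tapePos, Tape.mk'_left, Tape.mk'_right₀, Prod.mk.injEq, half_eq_append_iff,
    Tape.mk'_head, ListBlank.append, Tape.mk'_right]
  constructor
  · rintro ⟨l, r, ⟨rfl, hy, rfl⟩, rfl⟩
    exact ⟨hy, rfl⟩
  · rintro ⟨hy, rfl⟩
    exact ⟨_, _, ⟨rfl, hy, rfl⟩, rfl⟩

theorem state_applies {q q' : M.Q} {l w : List Bool} {p : Pos} :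
    Block.Applies ⟨[], e.state q, l, w⟩ (e.statePos q') p ↔
      q' = q ∧ p = (ListBlank.append l (ListBlank.mk []), ListBlank.append w (ListBlank.mk [])) := by
  unfold Block.Applies statePos
  simp only [Prod.mk.injEq, ListBlank.append]
  constructor
  · rintro ⟨a, b, ⟨rfl, h⟩, rfl⟩
    have hq : q' = q := by
      rcases prefix_or_prefix_of_append_eq h with h | h
      · exact e.state_free _ _ h
      · exact (e.state_free _ _ h).symm
    subst hq
    rw [append_left_cancel _ h]
    exact ⟨rfl, rfl⟩
  · rintro ⟨rfl, rfl⟩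
    exact ⟨_, _, ⟨rfl, rfl⟩, rfl⟩

/-- The operations lead from the given tape to one that carries the mark of acceptance. -/
def Reaches (h : List Block) (p : Pos) : Prop :=
  ∃ q : Pos, Block.Replay h p q ∧ q.1.head = true

theorem reaches_cons {b : Block} {h : List Block} {p : Pos} :
    Reaches (b :: h) p ↔ ∃ m, b.Applies p m ∧ Reaches h m := by
  constructor
  · rintro ⟨q, ⟨m, h1, h2⟩, h3⟩; exact ⟨m, h1, q, h2, h3⟩
  · rintro ⟨m, h1, q, h2, h3⟩; exact ⟨q, ⟨m, h1, h2⟩, h3⟩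

/-- The history of rules is that of an accepting computation. -/
theorem sound (h : List (Rule M)) (hh : ∀ r ∈ h, r.Valid) (c : M.Cfg)
    (ht : ∀ k, Reaches (h.map (e.tapeBlock k)) (e.tapePos (c.tape k)))
    (hs : Reaches (h.map e.stateBlock) (e.statePos c.state)) :
    ∃ n d, M.ReachesIn n c d ∧ M.Halted d ∧ d.state ∈ M.accept := by
  induction h generalizing c with
  | nil =>
    -- Without a final rule the left half of the state tape stays blank, so the mark of acceptance
    -- is missing. Only the state section enforces it: on the other tapes a code word may also begin
    -- with `true`.
    obtain ⟨q, rfl, hq⟩ := hs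
    simp [statePos] at hq
  | cons r h ih =>
    have hr := hh r (by simp)
    obtain ⟨q, y, x, _ | a⟩ := r
    · simp only [List.map_cons, reaches_cons, tapeBlock, stateBlock, final_applies,
        state_applies] at ht hs
      -- A final rule already shows that the present configuration is accepting; the rest of the
      -- history is irrelevant.
      obtain ⟨_, ⟨rfl, -⟩, -⟩ := hs
      have hy : (fun k => (c.tape k).head) = y := funext fun k => by
        obtain ⟨_, ⟨h, -⟩, -⟩ := ht k
        exact h
      refine ⟨0, c, rfl, ?_, hr.1⟩
      rintro d ⟨a, ha, -⟩
      have hr2 : M.δ c.state y = ∅ := hr.2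
      rw [hy, hr2] at ha
      exact ha
    · simp only [List.map_cons, reaches_cons, tapeBlock, stateBlock, actBlock_applies,
        state_applies] at ht hs
      obtain ⟨_, ⟨rfl, rfl⟩, hs⟩ := hs
      have hy : (fun k => (c.tape k).head) = y := funext fun k => by
        obtain ⟨_, ⟨-, h, -⟩, -⟩ := ht k
        exact h
      obtain ⟨n, d, h1, h2⟩ := ih (fun r hr => hh r (by simp [hr]))
        ⟨a.1, fun k => NTM.act (a.2 k) (c.tape k)⟩ (fun k => by
          obtain ⟨_, ⟨-, -, rfl⟩, h⟩ := ht k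
          exact h) hs
      refine ⟨n + 1, d, ⟨_, ⟨a, ?_, rfl⟩, h1⟩, h2⟩
      rw [hy]
      exact hr

/-- An accepting computation has a history of rules. -/
theorem complete {n : ℕ} {c d : M.Cfg} (hn : M.ReachesIn n c d) (hd : M.Halted d)
    (hd' : d.state ∈ M.accept) : ∃ h : List (Rule M), h.length = n + 1 ∧ (∀ r ∈ h, r.Valid) ∧
      (∀ k, Reaches (h.map (e.tapeBlock k)) (e.tapePos (c.tape k))) ∧
      Reaches (h.map e.stateBlock) (e.statePos c.state) := by
  induction n generalizing c with
  | zero =>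
    obtain rfl : c = d := hn
    refine ⟨[(c.state, fun k => (c.tape k).head, fun k => (c.tape k).head, none)], rfl, ?_, ?_, ?_⟩
    · simp only [List.mem_singleton, forall_eq]
      refine ⟨hd', Set.eq_empty_iff_forall_notMem.2 fun a ha => hd _ ⟨a, ha, rfl⟩⟩
    · intro k
      simp only [List.map_cons, List.map_nil, reaches_cons, tapeBlock, final_applies]
      exact ⟨_, ⟨trivial, rfl⟩, _, rfl, by simp⟩
    · simp only [List.map_cons, List.map_nil, reaches_cons, stateBlock, state_applies]
      exact ⟨_, ⟨trivial, rfl⟩, _, rfl, by simp [ListBlank.append]⟩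
  | succ n ih =>
    obtain ⟨_, ⟨a, ha, rfl⟩, hn⟩ := hn
    obtain ⟨h, h1, h2, h3, h4⟩ := ih hn
    refine ⟨(c.state, fun k => (c.tape k).head, fun k => (c.tape k).left.head, some a) :: h,
      by simp [h1], ?_, ?_, ?_⟩
    · rintro r (_ | ⟨_, hr⟩)
      · exact ha
      · exact h2 r hr
    · intro k
      simp only [List.map_cons, reaches_cons, tapeBlock, actBlock_applies]
      exact ⟨_, ⟨trivial, trivial, rfl⟩, h3 k⟩
    · simp only [List.map_cons, reaches_cons, stateBlock, state_applies]
      exact ⟨_, ⟨trivial, rfl⟩, h4⟩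

/-- The list of the valid rules. -/
noncomputable def rules (M : NTM) : List (Rule M) :=
  (Set.toFinite {r : Rule M | r.Valid}).toFinset.toList

theorem mem_rules {r : Rule M} : r ∈ rules M ↔ r.Valid := by
  simp [rules]

theorem nodup_rules : (rules M).Nodup := Finset.nodup_toList _

/-- The sections other than the one of the input tape. -/
noncomputable def otherSections : List (List Block) :=
  (rules M).map e.stateBlock ::
    ((Finset.univ.erase M.inputTape).toList.map fun k => (rules M).map (e.tapeBlock k))

/-- The code of the machine. -/
noncomputable def machineCode : List Sym :=
  fullCode ((rules M).map (e.tapeBlock M.inputTape) :: e.otherSections)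

/-- The bits are pushed from the last to the first, each below a `true`, which produces the code
words `[true, b]` of the input symbols in their order. -/
theorem content_loadBits (x : List Bool) :
    content (Prog.loadBits (x.reverse.map .bit) []) = e.half (ListBlank.mk (x.map M.bit)) := by
  have h : ∀ x : List Bool, content (Prog.loadBits (x.reverse.map .bit) []) =
      ListBlank.mk (x.flatMap fun b => [true, b]) := by
    intro x
    induction x with
    | nil => rfl
    | cons b x ih =>
      have h1 : ∀ (x : List Bool) (l l' : List Sym), content l = content l' →
          content (Prog.loadBits (x.map .bit) l) = content (Prog.loadBits (x.map .bit) l') := by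
        intro x
        induction x with
        | nil => intro l l' h; exact h
        | cons b x ih =>
          intro l l' h
          refine ih _ _ ?_
          rw [content_cons_bit, content_cons_bit, content_cons_bit, content_cons_bit, h]
      have h2 : ∀ (x l l' : List Sym), Prog.loadBits (x ++ l) l' =
          Prog.loadBits l (Prog.loadBits x l') := by
        intro x l l'
        exact List.foldl_append
      rw [List.reverse_cons, List.map_append, h2]
      change content (.bit true :: .bit b :: _) = _
      rw [content_cons_bit, content_cons_bit, ih, ListBlank.cons_mk, ListBlank.cons_mk]
      rfl
  rw [h, half, ListBlank.flatMap_mk, List.flatMap_map]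
  congr 2
  funext b
  rw [e.sym_bit]

theorem tapePos_mk₁ (l : List M.Γ) :
    e.tapePos (Tape.mk₁ l) = (ListBlank.mk [], e.half (ListBlank.mk l)) := by
  rw [tapePos, Tape.mk₁, Tape.mk₂, Tape.mk'_left, Tape.mk'_right₀]
  simp only [half, ListBlank.flatMap_mk, List.flatMap_nil]

theorem statePos_start : e.statePos M.start = (ListBlank.mk [], ListBlank.mk []) := by
  rw [statePos, e.state_start]
  refine Prod.ext rfl ?_
  ext n
  rcases n with _ | _ | n <;> rfl

/-- The verdict on a witness is that on the history of rules which it picks. -/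
theorem verdict_iff (n : ℕ) (x u : List Bool) :
    Core.verdict (e.machineCode ++ List.replicate n mark)
      (Prog.loadBits (x.reverse.map .bit) []) (u.map .bit) = [] ↔
    (∀ k, Reaches ((history (rules M) u.length u).map (e.tapeBlock k))
      (e.tapePos ((M.init x).tape k))) ∧
      Reaches ((history (rules M) u.length u).map e.stateBlock) (e.statePos (M.init x).state) := by
  have hsec : ∀ (f : Rule M → Block) (r : ListBlank Bool),
      SectionAccepts ((rules M).map f) r u ↔
        Reaches ((history (rules M) u.length u).map f) (ListBlank.mk [], r) := by
    intro f r
    rw [SectionAccepts, Reaches, history_map]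
  rw [machineCode, verdict_fullCode, e.content_loadBits]
  simp only [otherSections, List.mem_cons, List.mem_map, Finset.mem_toList, Finset.mem_erase,
    Finset.mem_univ, and_true, forall_eq_or_imp, forall_exists_index, and_imp,
    forall_apply_eq_imp_iff₂, hsec, content_nil]
  have hin : e.tapePos ((M.init x).tape M.inputTape) =
      (ListBlank.mk [], e.half (ListBlank.mk (x.map M.bit))) := by
    rw [← tapePos_mk₁]
    simp [NTM.init]
  have hout : ∀ k, k ≠ M.inputTape → e.tapePos ((M.init x).tape k) =
      (ListBlank.mk [], ListBlank.mk []) := by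
    intro k hk
    simp only [NTM.init, if_neg hk, tapePos_mk₁]
    simp only [half, ListBlank.flatMap_mk, List.flatMap_nil]
  have hst : e.statePos (M.init x).state = (ListBlank.mk [], ListBlank.mk []) := e.statePos_start
  rw [hst, ← hin]
  constructor
  · rintro ⟨h1, h2, h3⟩
    refine ⟨fun k => ?_, h2⟩
    by_cases hk : k = M.inputTape
    · rw [hk]; exact h1
    · rw [hout k hk]; exact h3 k hk
  · rintro ⟨h1, h2⟩
    refine ⟨h1 _, h2, fun k hk => ?_⟩
    rw [← hout k hk]
    exact h1 k

theorem accepts_of_verdict {n : ℕ} {x u : List Bool}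
    (h : Core.verdict (e.machineCode ++ List.replicate n mark)
      (Prog.loadBits (x.reverse.map .bit) []) (u.map .bit) = []) : M.Accepts x := by
  obtain ⟨h1, h2⟩ := (e.verdict_iff n x u).1 h
  exact e.sound _ (fun r hr => mem_rules.1 (mem_of_mem_history hr)) _ h1 h2

theorem exists_verdict_of_accepts (n : ℕ) {x : List Bool} {t m : ℕ} (ht : M.HaltsWithin x t)
    (h : M.Accepts x) (hm : (t + 1) * ((rules M).length + 1) ≤ m) : ∃ u : List Bool, u.length = m ∧
      Core.verdict (e.machineCode ++ List.replicate n mark)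
        (Prog.loadBits (x.reverse.map .bit) []) (u.map .bit) = [] := by
  obtain ⟨k, d, h1, h2, h3⟩ := h
  have hk := ht k d h1
  obtain ⟨l, h4, h5, h6, h7⟩ := e.complete h1 h2 h3
  -- The history has one rule for each of the `k` steps and a final one. The extra summand in
  -- `(rules M).length + 1` pays for the number of passes, the rest for the bits.
  have h8 : (k + 1) * ((rules M).length + 1) ≤ m :=
    le_trans (Nat.mul_le_mul_right _ (by omega)) hm
  have h9 : l.length * (rules M).length + l.length ≤ m := by rw [h4]; exact h8
  obtain ⟨u, hu, hu'⟩ := exists_history nodup_rules l (fun r hr => mem_rules.2 (h5 r hr))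
    (n := m) (m := m) (by omega) (by omega)
  refine ⟨u, hu, (e.verdict_iff n x u).2 ?_⟩
  rw [hu, hu']
  exact ⟨h6, h7⟩

end Coding

/-! ### Code words of machines -/

/-- The four bits that code a token. -/
def encode : Tok → List Bool
  | .push l b => [false, true, l, b]
  | .pop l b => [false, false, l, b]
  | .rule => [true, false, false, false]
  | .endSection => [true, false, false, true]
  | .endCode => [true, false, true, false]
  | .double => [true, false, true, true]
  | .pad => [true, true, false, false]

theorem length_encode (t : Tok) : (encode t).length = 4 := by cases t <;> rfl

theorem parse_encode (t : Tok) (x : List Bool) (W D C : List Sym) :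
    parse (encode t ++ x) W D C =
      if t = .endCode then some (x, (encode t).reverse.map .bit ++ W, D, C)
      else if t = .double then parse x ((encode t).reverse.map .bit ++ W) (mark :: D) C
      else parse x ((encode t).reverse.map .bit ++ W) D (.tok t :: C) := by
  cases t <;> rfl

theorem parse_toks (ts : List Tok) (h : ∀ t ∈ ts, t ≠ .endCode ∧ t ≠ .double) (x : List Bool)
    (W D C : List Sym) : parse (ts.flatMap encode ++ x) W D C =
      parse x ((ts.flatMap encode).reverse.map .bit ++ W) D ((ts.map Sym.tok).reverse ++ C) := by
  induction ts generalizing W C with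
  | nil => rfl
  | cons t ts ih =>
    have ht := h t (by simp)
    rw [List.flatMap_cons, List.append_assoc, parse_encode, if_neg ht.1, if_neg ht.2,
      ih fun t ht => h t (by simp [ht])]
    simp

theorem parse_doubles (n : ℕ) (x : List Bool) (W D C : List Sym) :
    parse ((List.replicate n Tok.double).flatMap encode ++ x) W D C =
      parse x (((List.replicate n Tok.double).flatMap encode).reverse.map .bit ++ W)
        (List.replicate n mark ++ D) C := by
  induction n generalizing W D with
  | zero => rfl
  | succ n ih =>
    rw [List.replicate_succ, List.flatMap_cons, List.append_assoc, parse_encode, if_neg (by simp),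
      if_pos rfl, ih, List.replicate_succ']
    simp

/-- The word that codes a machine with the tokens `ts`, with the number `b` that determines the
length of the witnesses, and `p` padding tokens. -/
def codeWord (b p : ℕ) (ts : List Tok) : List Bool :=
  (List.replicate b Tok.double ++ (ts ++ List.replicate p Tok.pad) ++ [Tok.endCode]).flatMap encode

theorem length_codeWord (b p : ℕ) (ts : List Tok) :
    (codeWord b p ts).length = 4 * (b + ts.length + p + 1) := by
  have h : ∀ l : List Tok, (l.flatMap encode).length = 4 * l.length := by
    intro l
    induction l with
    | nil => rfl
    | cons t l ih => rw [List.flatMap_cons, List.length_append, ih, length_encode]; simp; omega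
  rw [codeWord, h]
  simp
  omega

theorem parse_codeWord (b p : ℕ) (ts : List Tok) (h : ∀ t ∈ ts, t ≠ .endCode ∧ t ≠ .double)
    (y : List Bool) : parse (codeWord b p ts ++ y) [] [] [] =
      some (y, (codeWord b p ts).reverse.map .bit, List.replicate b mark,
        (ts.map Sym.tok ++ List.replicate p mark).reverse) := by
  have h' : ∀ t ∈ ts ++ List.replicate p Tok.pad, t ≠ .endCode ∧ t ≠ .double := by
    intro t ht
    rcases List.mem_append.1 ht with ht | ht
    · exact h t ht
    · rw [List.eq_of_mem_replicate ht]; simp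
  have h1 : codeWord b p ts ++ y = (List.replicate b Tok.double).flatMap encode ++
      ((ts ++ List.replicate p Tok.pad).flatMap encode ++ (encode .endCode ++ y)) := by
    simp [codeWord]
  rw [h1, parse_doubles, parse_toks _ h', parse_encode, if_pos rfl]
  simp [codeWord]

theorem loadBits_append (x l l' : List Sym) :
    Prog.loadBits (x ++ l) l' = Prog.loadBits l (Prog.loadBits x l') :=
  List.foldl_append

/-- The stacks kept after parsing can be loaded so as to recreate the full input: loading the bit
`c`, then `y`, then the code word amounts to loading their concatenation. -/
theorem accepted_codeWord (b p : ℕ) (ts : List Tok) (h : ∀ t ∈ ts, t ≠ .endCode ∧ t ≠ .double)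
    (y : List Bool) : Accepted (codeWord b p ts ++ y) ↔
      if 2 ^ b ≤ y.length then
        Core.verdict (ts.map Sym.tok ++ List.replicate p mark)
          (Prog.loadBits ((codeWord b p ts).reverse.map .bit) []) (y.map .bit) ≠ []
      else ∀ c : Bool, ∃ v : List Bool, v.length = 2 ^ (codeWord b p ts ++ y).length ∧
        Core.verdict (ts.map Sym.tok ++ List.replicate p mark)
          (Prog.loadBits ((codeWord b p ts ++ y ++ [c]).reverse.map .bit) []) (v.map .bit) = [] := by
  rw [Accepted, parse_codeWord b p ts h]
  simp only [Option.some.injEq, exists_eq_left', List.reverse_reverse, List.length_replicate]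
  have hload : ∀ c : Bool,
      Prog.loadBits ((codeWord b p ts ++ y ++ [c]).reverse.map .bit) [] =
        Prog.loadBits ((codeWord b p ts).reverse.map .bit)
          (Prog.loadBits (y.reverse.map .bit) [.bit true, .bit c]) := by
    intro c
    rw [List.reverse_append, List.reverse_append, List.map_append, List.map_append,
      loadBits_append, loadBits_append]
    rfl
  simp only [hload]

theorem exists_toks {M : NTM} (e : Coding M) : ∃ ts : List Tok, ts.map Sym.tok = e.machineCode ∧
    ∀ t ∈ ts, t ≠ .endCode ∧ t ≠ .double := by
  have key : ∀ l : List Sym, (∀ a ∈ l, ∃ t, a = .tok t ∧ t ≠ .endCode ∧ t ≠ .double) →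
      ∃ ts : List Tok, ts.map Sym.tok = l ∧ ∀ t ∈ ts, t ≠ .endCode ∧ t ≠ .double := by
    intro l
    induction l with
    | nil => intro _; exact ⟨[], rfl, by simp⟩
    | cons a l ih =>
      intro h
      obtain ⟨t, rfl, ht⟩ := h a (by simp)
      obtain ⟨ts, rfl, hts⟩ := ih fun a ha => h a (by simp [ha])
      refine ⟨t :: ts, rfl, ?_⟩
      rintro t' (_ | ⟨_, h⟩)
      · exact ht
      · exact hts _ h
  apply key
  intro a ha
  simp only [Coding.machineCode, fullCode, sectionCode, List.mem_flatMap, List.mem_append,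
    List.mem_cons, List.not_mem_nil, or_false, Block.toks, List.mem_map] at ha
  obtain ⟨bs, -, ⟨bk, -, rfl | ((⟨x, -, rfl⟩ | ⟨x, -, rfl⟩) | ⟨x, -, rfl⟩) | ⟨x, -, rfl⟩⟩ | rfl⟩ := ha
  all_goals exact ⟨_, rfl, by simp, by simp⟩

/-! ### Membership in NEXP -/

/-- The language of the universal machine. -/
def universalLanguage : Language Bool := {x | Accepted x}

theorem universalLanguage_mem_NEXP : universalLanguage ∈ NEXP := by
  refine Set.mem_iUnion.2 ⟨2, Prog.universal.toNTM, 4000 * 2 ^ 4, fun x => ?_⟩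
  obtain ⟨R, hR, hR'⟩ := Prog.spec_universal x
  have hle : 4000 * 2 ^ (4 * x.length) ≤ 4000 * 2 ^ 4 * 2 ^ (x.length ^ 2) + 4000 * 2 ^ 4 := by
    -- This is `(n - 2) ^ 2 ≥ 0`, and allows the exponent `k = 2` in the definition of `NEXP`.
    have h1 : 4 * x.length ≤ 4 + x.length ^ 2 := by
      rcases le_total x.length 2 with h | h
      · nlinarith
      · obtain ⟨k, hk⟩ := Nat.exists_eq_add_of_le h
        rw [hk]; ring_nf; omega
    calc 4000 * 2 ^ (4 * x.length) ≤ 4000 * 2 ^ (4 + x.length ^ 2) := by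
          gcongr; norm_num
      _ = 4000 * 2 ^ 4 * 2 ^ (x.length ^ 2) := by rw [pow_add, mul_assoc]
      _ ≤ _ := Nat.le_add_right _ _
  obtain ⟨h1, h2⟩ := Prog.toNTM_spec (hR.mono hle)
  exact ⟨h1, h2.trans hR'⟩

/-! ### Choice of the parameters -/

theorem exists_forall_mul_pow_le (A k : ℕ) : ∃ n₀, ∀ n ≥ n₀, A * (n + 1) ^ k ≤ 2 ^ n := by
  have h := (tendsto_pow_const_div_const_pow_of_one_lt k (r := (2 : ℝ)) one_lt_two).comp
    (Filter.tendsto_add_atTop_nat 1)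
  have h' := h.eventually (gt_mem_nhds (show (0 : ℝ) < 1 / (2 * (A + 1)) by positivity))
  obtain ⟨n₀, hn₀⟩ := Filter.eventually_atTop.1 h'
  refine ⟨n₀, fun n hn => ?_⟩
  have h1 := hn₀ n hn
  simp only [Function.comp] at h1
  rw [div_lt_div_iff₀ (by positivity) (by positivity), one_mul, pow_succ (2 : ℝ) n] at h1
  have h2 : (A : ℝ) * ((n : ℝ) + 1) ^ k ≤ 2 ^ n := by
    have h3 : (0 : ℝ) ≤ ((n : ℝ) + 1) ^ k := by positivity
    push_cast at h1
    nlinarith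
  exact_mod_cast h2

/-- Raising the left end to a fixed power makes it as large as desired and costs only a constant
factor in the exponent. The factor 4 fits the lengths of code words, whose tokens have four bits. -/
theorem IsRobust.exists_interval {S : Set ℕ} (hS : IsRobust S) (B K : ℕ) :
    ∃ m ≥ B, ∀ n, 4 * m ≤ n → n ≤ (4 * m) ^ K → n ∈ S := by
  obtain ⟨m, hm, h⟩ := hS.2 ((B + 3) * (K + 1)) (by positivity)
  refine ⟨m ^ (B + 1), ?_, fun n hn hn' => h n ?_ (hn'.trans ?_)⟩
  · calc B ≤ 2 ^ B := Nat.lt_two_pow_self.le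
      _ ≤ m ^ B := Nat.pow_le_pow_left hm _
      _ ≤ m ^ (B + 1) := Nat.pow_le_pow_right (by omega) (by omega)
  · have : m ≤ m ^ (B + 1) := Nat.le_self_pow (by omega) m
    omega
  · have h4 : 4 * m ^ (B + 1) ≤ m ^ (B + 3) := by
      have : 4 ≤ m ^ 2 := by nlinarith
      calc 4 * m ^ (B + 1) ≤ m ^ 2 * m ^ (B + 1) := by gcongr
        _ = m ^ (B + 3) := by ring
    calc (4 * m ^ (B + 1)) ^ K ≤ (m ^ (B + 3)) ^ K := Nat.pow_le_pow_left h4 _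
      _ = m ^ ((B + 3) * K) := (pow_mul _ _ _).symm
      _ ≤ m ^ ((B + 3) * (K + 1)) := Nat.pow_le_pow_right (by omega) (by gcongr; omega)

/-- The lengths of the witnesses can be chosen such that they suffice for the computations of a
machine that halts within `c * n ^ k + c` steps, and the words that are reached from a code word of
length `4 * m` have polynomial length. -/
theorem exists_parameters (c k ρ l : ℕ) : ∃ n₀ K, ∀ m ≥ n₀, ∃ b, b + l + 1 ≤ m ∧
    (c * (4 * m) ^ k + c + 1) * (ρ + 1) ≤ 2 ^ b ∧ 4 * m + 2 ^ b ≤ (4 * m) ^ K ∧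
    ∀ n ≥ 4 * m, (c * (n + 1) ^ k + c + 1) * (ρ + 1) ≤ 2 ^ n := by
  set A := (2 * c + 1) * (ρ + 1) with hA
  have hpoly : ∀ n, 0 < n → (c * n ^ k + c + 1) * (ρ + 1) ≤ A * n ^ k := by
    intro n hn
    have h1 : 1 ≤ n ^ k := Nat.one_le_pow _ _ hn
    calc (c * n ^ k + c + 1) * (ρ + 1) ≤ (c * n ^ k + c * n ^ k + n ^ k) * (ρ + 1) := by
          gcongr
          nlinarith
      _ = A * n ^ k := by rw [hA]; ring
  obtain ⟨n₁, hn₁⟩ := exists_forall_mul_pow_le A k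
  obtain ⟨n₂, hn₂⟩ := exists_forall_mul_pow_le (2 ^ (l + 1) * (A * 4 ^ k)) k
  -- Here `n₁` serves the guessed simulations and `n₂` the room for the code, while `2 * A` ensures
  -- `1 + 2 * A ≤ 4 * m`, which absorbs the constants into one more factor `4 * m`.
  refine ⟨n₁ + n₂ + 2 * A + l + 2, k + 2, fun m hm => ?_⟩
  have hval : 1 < (c * (4 * m) ^ k + c + 1) * (ρ + 1) ∨
      (c * (4 * m) ^ k + c + 1) * (ρ + 1) ≤ 1 := by omega
  have hm2 := hn₂ m (by omega)
  have hv : (c * (4 * m) ^ k + c + 1) * (ρ + 1) ≤ 2 ^ (m - (l + 1)) := by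
    refine (hpoly _ (by omega)).trans ?_
    refine Nat.le_of_mul_le_mul_left ?_ (Nat.two_pow_pos (l + 1))
    rw [← pow_add, Nat.add_sub_cancel' (by omega)]
    refine le_trans (le_of_eq ?_) ((Nat.mul_le_mul_left (2 ^ (l + 1) * (A * 4 ^ k))
      (Nat.pow_le_pow_left (Nat.le_succ m) k)).trans hm2)
    rw [mul_pow]
    ring
  -- The least `b` that suffices for the witnesses is taken, so `2 ^ b` exceeds the polynomial bound
  -- by a factor of at most 2.
  refine ⟨Nat.clog 2 ((c * (4 * m) ^ k + c + 1) * (ρ + 1)), ?_, Nat.le_pow_clog (by omega) _, ?_, ?_⟩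
  · have := Nat.clog_le_of_le_pow hv
    omega
  · have h1 : 2 ^ Nat.clog 2 ((c * (4 * m) ^ k + c + 1) * (ρ + 1)) ≤ 2 * (A * (4 * m) ^ k) := by
      rcases hval with h | h
      · have h2 := Nat.pow_pred_clog_lt_self (b := 2) (by omega) h
        have h3 : 0 < Nat.clog 2 ((c * (4 * m) ^ k + c + 1) * (ρ + 1)) :=
          Nat.clog_pos (by omega) (by omega)
        obtain ⟨j, hj⟩ : ∃ j, Nat.clog 2 ((c * (4 * m) ^ k + c + 1) * (ρ + 1)) = j + 1 :=
          ⟨_, (Nat.succ_pred_eq_of_pos h3).symm⟩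
        rw [hj] at h2 ⊢
        rw [pow_succ, mul_comm]
        exact Nat.mul_le_mul_left _ (h2.le.trans (hpoly _ (by omega)))
      · rw [Nat.clog_of_right_le_one h]
        have : 0 < A * (4 * m) ^ k := by
          have : 0 < 4 * m := by omega
          positivity
        omega
    have h2 : 1 ≤ (4 * m) ^ k := Nat.one_le_pow _ _ (by omega)
    calc 4 * m + 2 ^ Nat.clog 2 ((c * (4 * m) ^ k + c + 1) * (ρ + 1))
        ≤ 4 * m * (4 * m) ^ k + 2 * (A * (4 * m) ^ k) * 1 := by
          rw [mul_one]
          exact Nat.add_le_add (Nat.le_mul_of_pos_right _ h2) h1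
      _ ≤ 4 * m * (4 * m) ^ k + 2 * (A * (4 * m) ^ k) * (4 * m) := by
          gcongr; omega
      _ = (1 + 2 * A) * (4 * m) * (4 * m) ^ k := by ring
      _ ≤ (4 * m) * (4 * m) * (4 * m) ^ k := by gcongr; omega
      _ = (4 * m) ^ (k + 2) := by ring
  · intro n hn
    exact (hpoly _ (by omega)).trans (hn₁ n (by omega))

/-! ### The diagonal argument -/

theorem mem_iff_of_slice_eq {L L' : Language Bool} {x : List Bool}
    (h : slice L x.length = slice L' x.length) : x ∈ L ↔ x ∈ L' := by
  have := Set.ext_iff.1 h x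
  simpa [slice] using this

theorem universalLanguage_notMem_ro_NP : universalLanguage ∉ ro NP := by
  rintro ⟨S, hS, L', hL', hagree⟩
  obtain ⟨k, M, c, hM⟩ := Set.mem_iUnion.1 hL'
  obtain ⟨e⟩ := nonempty_coding M
  obtain ⟨ts, hts, hts'⟩ := exists_toks e
  obtain ⟨n₀, K, hpar⟩ := exists_parameters c k (Coding.rules M).length ts.length
  obtain ⟨m, hm, hmS⟩ := hS.exists_interval n₀ K
  obtain ⟨b, hb, hwit, hlen, hsim⟩ := hpar m hm
  -- Padding brings the code word to exactly the length `4 * m`; padding tokens stand behind the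
  -- last section and have no effect on the verdict.
  obtain ⟨p, hp⟩ : ∃ p, b + ts.length + p + 1 = m := ⟨m - (b + ts.length + 1), by omega⟩
  set w := codeWord b p ts with hw
  have hwl : w.length = 4 * m := by rw [hw, length_codeWord, hp]
  -- All lengths from `4 * m` to `4 * m + 2 ^ b` lie in the robust set, so there `M` decides the
  -- universal language.
  have hiff : ∀ y : List Bool, y.length ≤ 2 ^ b → (Accepted (w ++ y) ↔ M.Accepts (w ++ y)) := by
    intro y hy
    rw [(hM _).2]
    refine mem_iff_of_slice_eq (L := universalLanguage) (hagree _ (hmS _ ?_ ?_))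
    · rw [List.length_append]; omega
    · rw [List.length_append]; omega
  have hstep : ∀ y : List Bool, y.length < 2 ^ b →
      (M.Accepts (w ++ y) ↔ ∀ x : Bool, M.Accepts (w ++ (y ++ [x]))) := by
    intro y hy
    rw [← hiff y hy.le, hw, accepted_codeWord b p ts hts', if_neg (by omega), hts]
    simp only [← hw]
    refine forall_congr' fun x => ?_
    rw [← List.append_assoc]
    constructor
    · rintro ⟨v, -, hv⟩
      exact e.accepts_of_verdict hv
    -- The machine runs on a word that is longer by one bit, while the witness length is determined
    -- by the shorter one; `hsim` is stated with `n + 1` for this purpose.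
    · intro h
      refine e.exists_verdict_of_accepts p (hM _).1 h ?_
      have := hsim (w ++ y).length (by rw [List.length_append]; omega)
      simpa [Nat.add_assoc] using this
  -- Induction on the distance `j` to the leaves of the binary tree of extensions of `w`.
  have htree : ∀ j, ∀ y : List Bool, y.length + j = 2 ^ b →
      (M.Accepts (w ++ y) ↔ ∀ v : List Bool, v.length = j → M.Accepts (w ++ (y ++ v))) := by
    intro j
    induction j with
    | zero => intro y _; simp
    | succ j ih =>
      intro y hy
      rw [hstep y (by omega)]
      constructor
      · rintro h (_ | ⟨x, v⟩) hv
        · cases hv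
        · have := (ih (y ++ [x]) (by simp; omega)).1 (h x) v (by simpa using hv)
          simpa using this
      · intro h x
        refine (ih (y ++ [x]) (by simp; omega)).2 fun v hv => ?_
        have := h (x :: v) (by simpa using hv)
        simpa using this
  have hleaf : ∀ v : List Bool, v.length = 2 ^ b → (M.Accepts (w ++ v) ↔
      Core.verdict (e.machineCode ++ List.replicate p mark)
        (Prog.loadBits (w.reverse.map .bit) []) (v.map .bit) ≠ []) := by
    intro v hv
    rw [← hiff v hv.le, hw, accepted_codeWord b p ts hts', if_pos hv.ge, hts]
  have hroot := htree (2 ^ b) [] (by simp)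
  simp only [List.nil_append, List.append_nil] at hroot
  by_cases hacc : M.Accepts w
  -- If `M` accepts `w`, a right witness of length exactly `2 ^ b` is itself a leaf, and this leaf
  -- is rejected although the root is accepted.
  · obtain ⟨v, hv, hv'⟩ := e.exists_verdict_of_accepts p (m := 2 ^ b) (hM w).1 hacc (by
      rw [hwl]; exact hwit)
    exact (hleaf v hv).1 (hroot.1 hacc v hv) hv'
  · refine hacc (hroot.2 fun v hv => (hleaf v hv).2 fun h => hacc ?_)
    exact e.accepts_of_verdict h

end Complexity

theorem mainTheorem7 : ¬ (Complexity.NEXP ⊆ Complexity.ro Complexity.NP) := fun h =>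
  Complexity.universalLanguage_notMem_ro_NP (h Complexity.universalLanguage_mem_NEXP)
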